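/- Let $\gamma$ be the standard Gaussian measure on $\mathbb R$ (mean $0$, variance $1$), let $A=\frac12\frac{\partial^2}{\partial x^2}-\frac x2\frac{\partial}{\partial x}$ be the Ornstein–Uhlenbeck generator, and let $e^{tA}$ be its semigroup, $(e^{tA}g)(x)=\int g\big(e^{-t/2}x+\sqrt{1-e^{-t}}\,y\big)\,d\gamma(y)$. For $n=N^2$ let $\mathcal A=\sum_{i=1}^n A_i$ be the generator on $\mathbb R^n$, with $A_i$ acting on the $i$-th coordinate; its semigroup $e^{t\mathcal A}$ is given by the same formula with $\gamma^{\otimes n}$ in place of $\gamma$. A probability measure $\mu$ on $\mathbb R$ satisfies the logarithmic Sobolev inequality (LSI) with constant $\theta$ if $\int f\log f\,d\mu\le\theta\int|\nabla\sqrt f|^2\,d\mu$ for every $f\ge 0$ with $\int f\,d\mu=1$ and $\sqrt f$ locally absolutely continuous. Let $K\ge 1$ be an integer. There is a constant $\alpha_K>0$, depending only on $K$, such that the following holds. Let $\nu=u\,d\gamma$ be a probability measure on $\mathbb R$ with mean zero and variance one such that (a) (subexponential decay) $\nu(\{|x|\ge y\})\le C_0\exp(-y^{q})$ for all $y\ge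 0$, with some constants $C_0,q>0$; (b) (regularity) $\nu$ has a positive Lebesgue density $e^{-U(x)}$ with $U\in C^{2K}(\mathbb R)$ and $|U^{(j)}(x)|\le C_{1,j}(1+x^2)^{C_{2,j}}$ for all $x\in\mathbb R$ and $0\le j\le 2K$, with some constants $C_{1,j},C_{2,j}$. Then there is a constant $C>0$, depending only on $K$ and on the constants in (a) and (b), such that for every $0<t\le\alpha_K$ there is a probability density $g_t$ with respect to $\gamma$, such that $g_t\,d\gamma$ has mean zero and variance one, with all of the following properties. 1. $\displaystyle\int\big|e^{tA}g_t-u\big|\,d\gamma\le C\,t^K.$ 2. The LSI constant changes by a factor of at most $2$: if $\nu=u\gamma$ satisfies the LSI with constant $\theta$, then $g_t\gamma$ satisfies it with constant $2\theta$; and if $g_t\gamma$ satisfies the LSI with constant $\theta$, then $u\gamma$ satisfies it with constant $2\theta$. 3. For every $N$, with $n=N^2$, $F=u^{\otimes n}$ and $G_t=g_t^{\otimes n}$, $\displaystyle\int\big|e^{t\mathcal A}G_t-F\big|\,d\gamma^{\otimes n}\le C\,N^2\,t^K.$ -/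

import Mathlib

open MeasureTheory ProbabilityTheory

namespace ReverseHeatFlow

noncomputable section

/-- The standard Gaussian distribution `γ` on `ℝ` (mean `0`, variance `1`). -/
abbrev γ : Measure ℝ := gaussianReal 0 1

/-- The product Gaussian `γ^{⊗ n}` on `ℝⁿ`. -/
abbrev γn (n : ℕ) : Measure (Fin n → ℝ) := Measure.pi (fun _ => γ)

/-- `g` is a probability density with respect to `γ`. -/
structure IsProbDensity (g : ℝ → ℝ) : Prop where
  measurable : Measurable g
  nonneg : ∀ x, 0 ≤ g x
  lintegral_eq_one : ∫⁻ x, ENNReal.ofReal (g x) ∂γ = 1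

/-- The measure `g dγ`. -/
def withGauss (g : ℝ → ℝ) : Measure ℝ := γ.withDensity (fun x => ENNReal.ofReal (g x))

/-- The measure `ν` has mean zero and variance one. (The variance in Mathlib vanishes when the second
moment is infinite, so the second condition contains the finiteness of the second moment.) -/
def IsStandardized (ν : Measure ℝ) : Prop :=
  ∫ x, x ∂ν = 0 ∧ variance (fun x : ℝ => x) ν = 1

/-- Subexponential decay of `ν`: `ν(|x| ≥ y) ≤ C exp(- y ^ q)` for all `y ≥ 0`. -/
def SubexpDecay (ν : Measure ℝ) (C q : ℝ) : Prop :=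
  ∀ y : ℝ, 0 ≤ y → ν.real {x | y ≤ |x|} ≤ C * Real.exp (-(y ^ q))

/-- `ν` has a positive Lebesgue density `exp(-U)` with `U` of class `C^m` and
`|U^{(j)}(x)| ≤ C₁(j) (1 + x²)^{C₂(j)}` for all `x` and all `j ≤ m`. -/
def RegularDensity (ν : Measure ℝ) (m : ℕ) (C₁ C₂ : ℕ → ℝ) : Prop :=
  ∃ U : ℝ → ℝ, ContDiff ℝ m U ∧
    ν = volume.withDensity (fun x => ENNReal.ofReal (Real.exp (-U x))) ∧
    ∀ j ≤ m, ∀ x : ℝ, |iteratedDeriv j U x| ≤ C₁ j * (1 + x ^ 2) ^ (C₂ j)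

/-- The logarithmic Sobolev inequality for `ν` with constant `θ`:
`∫ f log f dν ≤ θ ∫ |∇√f|² dν` for every `f ≥ 0` with `∫ f dν = 1`. Here `√f` is locally absolutely
continuous, so that `∇√f` exists almost everywhere; when the right-hand side is infinite there is
nothing to say, and when it is finite the entropy integral has to be finite too. -/
def LSI (ν : Measure ℝ) (θ : ℝ) : Prop :=
  ∀ f : ℝ → ℝ, (∀ x, 0 ≤ f x) →
    (∀ a b : ℝ, AbsolutelyContinuousOnInterval (fun x => √(f x)) a b) →
    ∫ x, f x ∂ν = 1 →
    Integrable (fun x => (deriv (fun y => √(f y)) x) ^ 2) ν →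
    Integrable (fun x => f x * Real.log (f x)) ν ∧
      ∫ x, f x * Real.log (f x) ∂ν ≤ θ * ∫ x, (deriv (fun y => √(f y)) x) ^ 2 ∂ν

/-- The Ornstein–Uhlenbeck semigroup, reversible with respect to a centred Gaussian measure `μ`, given
by Mehler's formula
`(P_t f)(x) = ∫ f (e^{-t/2} x + √(1 - e^{-t}) y) dμ(y)`.
For `μ = γ` this is `e^{tA}` with `A = ½ ∂² - (x/2) ∂` (see `hasDerivAt_ouSemigroup`), and for
`μ = γ^{⊗ n}` it is `e^{t𝒜}`, `𝒜 = ∑ᵢ Aᵢ` with `Aᵢ` acting on the `i`-th coordinate. -/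
def ouSemigroup {E : Type*} [AddCommGroup E] [Module ℝ E] [MeasurableSpace E] (μ : Measure E)
    (t : ℝ) (f : E → ℝ) (x : E) : ℝ :=
  ∫ y, f (Real.exp (-t / 2) • x + √(1 - Real.exp (-t)) • y) ∂μ

/-- The tensor power `u^{⊗ n}`. -/
def tensorPow (n : ℕ) (u : ℝ → ℝ) (x : Fin n → ℝ) : ℝ := ∏ i, u (x i)

/-- The Ornstein–Uhlenbeck generator `A = ½ ∂² - (x/2) ∂`. -/
def ouGenerator (f : ℝ → ℝ) (x : ℝ) : ℝ := 1 / 2 * deriv (deriv f) x - x / 2 * deriv f x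

lemma integrable_bdd {f : ℝ → ℝ} (hf : Continuous f) {M : ℝ} (hM : ∀ x, |f x| ≤ M) (a b : ℝ) :
    Integrable (fun y => f (a + b * y)) γ :=
  Integrable.of_bound (by fun_prop) M (Filter.Eventually.of_forall fun y => hM _)

lemma integrable_abs_id : Integrable (fun y : ℝ => |y|) γ := by
  have := (memLp_id_gaussianReal (μ := 0) (v := 1) 1).integrable (by simp)
  exact this.abs

/-- Differentiation of a Gaussian average with respect to a parameter. -/
lemma hasDerivAt_gauss {f : ℝ → ℝ} (hf : ContDiff ℝ 1 f) {M M' : ℝ} (hM : ∀ x, |f x| ≤ M)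
    (hM' : ∀ x, |deriv f x| ≤ M') {p q p' q' : ℝ → ℝ} {s : ℝ} {S : Set ℝ} (hS : S ∈ nhds s)
    {B : ℝ} (hp : ∀ r ∈ S, HasDerivAt p (p' r) r) (hq : ∀ r ∈ S, HasDerivAt q (q' r) r)
    (hpB : ∀ r ∈ S, |p' r| ≤ B) (hqB : ∀ r ∈ S, |q' r| ≤ B) :
    HasDerivAt (fun r => ∫ y, f (p r + q r * y) ∂γ)
      (∫ y, deriv f (p s + q s * y) * (p' s + q' s * y) ∂γ) s := by
  have hcf : Continuous f := hf.continuous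
  have hcf' : Continuous (deriv f) := hf.continuous_deriv le_rfl
  have hM'0 : 0 ≤ M' := (abs_nonneg _).trans (hM' 0)
  refine (hasDerivAt_integral_of_dominated_loc_of_deriv_le (μ := γ) (s := S)
    (F := fun r y => f (p r + q r * y))
    (F' := fun r y => deriv f (p r + q r * y) * (p' r + q' r * y))
    (bound := fun y => M' * (B + B * |y|)) hS ?_ ?_ ?_ ?_ ?_ ?_).2
  · exact Filter.Eventually.of_forall fun r => (integrable_bdd hcf hM _ _).aestronglyMeasurable
  · exact integrable_bdd hcf hM _ _
  · exact (by fun_prop : Continuous fun y => deriv f (p s + q s * y) * (p' s + q' s * y)).aestronglyMeasurable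
  · refine Filter.Eventually.of_forall fun y r hr => ?_
    rw [Real.norm_eq_abs, abs_mul]
    refine mul_le_mul (hM' _) ?_ (abs_nonneg _) hM'0
    refine (abs_add_le _ _).trans (add_le_add (hpB r hr) ?_)
    rw [abs_mul]
    exact mul_le_mul_of_nonneg_right (hqB r hr) (abs_nonneg _)
  · exact ((integrable_const B).add (integrable_abs_id.const_mul B)).const_mul M'
  · refine Filter.Eventually.of_forall fun y r hr => ?_
    have h1 : HasDerivAt f (deriv f (p r + q r * y)) (p r + q r * y) :=
      (hf.differentiable (by norm_num) _).hasDerivAt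
    exact h1.comp r ((hp r hr).add ((hq r hr).mul_const y))

/-- Gaussian integration by parts. -/
lemma gauss_ibp {f : ℝ → ℝ} (hf : ContDiff ℝ 1 f) {M M' : ℝ} (hM : ∀ x, |f x| ≤ M)
    (hM' : ∀ x, |deriv f x| ≤ M') (a b : ℝ) :
    ∫ y, f (a + b * y) * y ∂γ = b * ∫ y, deriv f (a + b * y) ∂γ := by
  have hcf : Continuous f := hf.continuous
  have hcf' : Continuous (deriv f) := hf.continuous_deriv le_rfl
  have hI1 : Integrable (fun y => f (a + b * y) * y) γ := by
    refine Integrable.mono' (integrable_abs_id.const_mul M) (by fun_prop) ?_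
    refine Filter.Eventually.of_forall fun y => ?_
    rw [Real.norm_eq_abs, abs_mul]
    exact mul_le_mul_of_nonneg_right (hM _) (abs_nonneg _)
  have hI2 := integrable_bdd hcf' hM' a b
  have hI3 := integrable_bdd hcf hM a b
  have key : ∀ h : ℝ → ℝ, Integrable h γ → Integrable (fun y => h y * gaussianPDFReal 0 1 y) := by
    intro h hh
    rw [γ, gaussianReal_of_var_ne_zero _ one_ne_zero,
      integrable_withDensity_iff_integrable_smul' (measurable_gaussianPDF _ _)
        (Filter.Eventually.of_forall fun _ => gaussianPDF_lt_top)] at hh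
    refine hh.congr (Filter.Eventually.of_forall fun y => ?_)
    simp [toReal_gaussianPDF, mul_comm]
  have hG : ∀ y, HasDerivAt (gaussianPDFReal 0 1) (-y * gaussianPDFReal 0 1 y) y := by
    intro y
    have h1 : HasDerivAt (fun y : ℝ => -(y - 0) ^ 2 / (2 * ((1 : NNReal) : ℝ))) (-y) y := by
      have := (((hasDerivAt_id y).sub_const 0).pow 2).neg.div_const (2 * ((1 : NNReal) : ℝ))
      refine this.congr_deriv ?_
      simp
      ring
    have h2 := h1.exp.const_mul ((√(2 * Real.pi * ((1 : NNReal) : ℝ)))⁻¹)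
    refine h2.congr_deriv ?_
    simp only [gaussianPDFReal]
    ring
  have hF : ∀ y, HasDerivAt (fun y => f (a + b * y)) (deriv f (a + b * y) * b) y := by
    intro y
    have h1 : HasDerivAt f (deriv f (a + b * y)) (a + b * y) :=
      (hf.differentiable (by norm_num) _).hasDerivAt
    have h2 : HasDerivAt (fun y => a + b * y) b y := by
      simpa using ((hasDerivAt_id y).const_mul b).const_add a
    exact h1.comp y h2
  have := integral_mul_deriv_eq_deriv_mul_of_integrable (u := fun y => f (a + b * y))
    (v := gaussianPDFReal 0 1) (u' := fun y => deriv f (a + b * y) * b)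
    (v' := fun y => -y * gaussianPDFReal 0 1 y) (fun y _ => hF y) (fun y _ => hG y)
    ((key _ hI1).neg.congr (Filter.Eventually.of_forall fun y => by
      simp only [Pi.neg_apply, Pi.mul_apply]; ring))
    ((key _ (hI2.mul_const b)).congr (Filter.Eventually.of_forall fun y => by
      simp only [Pi.mul_apply]))
    ((key _ hI3).congr (Filter.Eventually.of_forall fun y => by simp only [Pi.mul_apply]))
  rw [integral_gaussianReal_eq_integral_smul one_ne_zero,
    integral_gaussianReal_eq_integral_smul one_ne_zero, ← integral_const_mul]
  have h3 : ∫ y, gaussianPDFReal 0 1 y • (f (a + b * y) * y)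
      = - ∫ y, f (a + b * y) * (-y * gaussianPDFReal 0 1 y) := by
    rw [← integral_neg]
    congr 1
    ext y
    simp only [smul_eq_mul]
    ring
  rw [h3, this, neg_neg]
  congr 1
  ext y
  simp only [smul_eq_mul]
  ring

/-- The semigroup of the definition solves `∂_t (P_t f) = A (P_t f)` for `t > 0`, with the generator
`A` above (shown for bounded `f` of class `C²` with bounded derivatives). -/
theorem hasDerivAt_ouSemigroup {f : ℝ → ℝ} (hf : ContDiff ℝ 2 f) {M : ℝ} (hM : ∀ x, |f x| ≤ M)
    (hM' : ∀ x, |deriv f x| ≤ M) (hM'' : ∀ x, |deriv (deriv f) x| ≤ M) {t : ℝ} (ht : 0 < t)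
    (x : ℝ) :
    HasDerivAt (fun s => ouSemigroup γ s f x) (ouGenerator (ouSemigroup γ t f) x) t := by
  have hf1 : ContDiff ℝ 1 f := hf.of_le (by norm_num)
  have hf2 : ContDiff ℝ 1 (deriv f) := by
    have : ContDiff ℝ (1 + 1) f := by simpa [one_add_one_eq_two] using hf
    exact (contDiff_succ_iff_deriv.1 this).2.2
  set a := Real.exp (-t / 2) with ha
  set b := √(1 - Real.exp (-t)) with hb
  have hlt : ∀ r : ℝ, 0 < r → 0 < 1 - Real.exp (-r) := fun r hr => by
    have : Real.exp (-r) < 1 := by rw [Real.exp_lt_one_iff]; linarith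
    linarith
  have hb0 : 0 < b := Real.sqrt_pos.2 (hlt t ht)
  -- the two space derivatives
  have hspace : ∀ h : ℝ → ℝ, ContDiff ℝ 1 h → (∀ x, |h x| ≤ M) → (∀ x, |deriv h x| ≤ M) →
      ∀ x, HasDerivAt (fun z => ∫ y, h (a * z + b * y) ∂γ)
        (a * ∫ y, deriv h (a * x + b * y) ∂γ) x := by
    intro h h1 h2 h3 x
    have := hasDerivAt_gauss h1 h2 h3 (p := fun z => a * z) (q := fun _ => b) (p' := fun _ => a)
      (q' := fun _ => 0) (s := x) (S := Set.univ) Filter.univ_mem (B := |a|)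
      (fun r _ => by simpa using (hasDerivAt_id r).const_mul a)
      (fun r _ => hasDerivAt_const r b) (fun _ _ => le_rfl) (fun _ _ => by simp)
    refine this.congr_deriv ?_
    rw [← integral_const_mul]
    congr 1
    ext y
    ring
  have hP : ouSemigroup γ t f = fun z => ∫ y, f (a * z + b * y) ∂γ := rfl
  have hd1 : deriv (ouSemigroup γ t f) = fun z => a * ∫ y, deriv f (a * z + b * y) ∂γ := by
    rw [hP]
    ext z
    exact (hspace f hf1 hM hM' z).deriv
  have hd2 : deriv (deriv (ouSemigroup γ t f)) x
      = a * (a * ∫ y, deriv (deriv f) (a * x + b * y) ∂γ) := by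
    rw [hd1]
    exact ((hspace (deriv f) hf2 hM' hM'' x).const_mul a).deriv
  -- the time derivative
  set p' : ℝ → ℝ := fun r => Real.exp (-r / 2) * (-1 / 2) * x with hp'
  set q' : ℝ → ℝ := fun r => Real.exp (-r) / (2 * √(1 - Real.exp (-r))) with hq'
  have hpd : ∀ r : ℝ, HasDerivAt (fun r : ℝ => Real.exp (-r / 2) * x) (p' r) r := by
    intro r
    exact ((((hasDerivAt_id r).neg.div_const 2).exp).mul_const x)
  have hqd : ∀ r : ℝ, 0 < r → HasDerivAt (fun r : ℝ => √(1 - Real.exp (-r))) (q' r) r := by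
    intro r hr
    have h1 : HasDerivAt (fun r : ℝ => 1 - Real.exp (-r)) (Real.exp (-r)) r := by
      have := ((hasDerivAt_id r).neg.exp).const_sub 1
      refine this.congr_deriv ?_
      simp
    exact h1.sqrt (hlt r hr).ne'
  have hpc : ContinuousAt p' t := by
    simp only [hp']
    fun_prop
  have hqc : ContinuousAt q' t := by
    simp only [hq']
    refine ContinuousAt.div (by fun_prop) (by fun_prop) ?_
    exact (mul_pos two_pos hb0).ne'
  have hev : ∀ᶠ r in nhds t, 0 < r ∧ |p' r| ≤ |p' t| + |q' t| + 1 ∧ |q' r| ≤ |p' t| + |q' t| + 1 := by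
    have e1 : ∀ᶠ r in nhds t, |p' r| < |p' t| + |q' t| + 1 :=
      hpc.abs.eventually_lt continuousAt_const (by have := abs_nonneg (q' t); linarith)
    have e2 : ∀ᶠ r in nhds t, |q' r| < |p' t| + |q' t| + 1 :=
      hqc.abs.eventually_lt continuousAt_const (by have := abs_nonneg (p' t); linarith)
    filter_upwards [lt_mem_nhds ht, e1, e2] with r h1 h2 h3 using ⟨h1, h2.le, h3.le⟩
  have htime := hasDerivAt_gauss hf1 hM hM' (p := fun r => Real.exp (-r / 2) * x)
    (q := fun r => √(1 - Real.exp (-r))) (p' := p') (q' := q') (s := t) hev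
    (fun r _ => hpd r) (fun r hr => hqd r hr.1) (fun r hr => hr.2.1) (fun r hr => hr.2.2)
  refine htime.congr_deriv ?_
  have hI2 := integrable_bdd hf2.continuous hM' (a * x) b
  have hI1 : Integrable (fun y => deriv f (a * x + b * y) * y) γ := by
    have hc := hf2.continuous
    refine Integrable.mono' (integrable_abs_id.const_mul M) (by fun_prop) ?_
    refine Filter.Eventually.of_forall fun y => ?_
    rw [Real.norm_eq_abs, abs_mul]
    exact mul_le_mul_of_nonneg_right (hM' _) (abs_nonneg _)
  have hsplit : ∫ y, deriv f (a * x + b * y) * (p' t + q' t * y) ∂γ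
      = p' t * ∫ y, deriv f (a * x + b * y) ∂γ + q' t * ∫ y, deriv f (a * x + b * y) * y ∂γ := by
    rw [← integral_const_mul, ← integral_const_mul,
      ← integral_add (hI2.const_mul _) (hI1.const_mul _)]
    congr 1
    ext y
    ring
  have haa : Real.exp (-t) = a * a := by
    rw [ha, ← Real.exp_add]
    congr 1
    ring
  have hqb : q' t * b = a * a / 2 := by
    have hq1 : q' t = a * a / (2 * b) := by rw [← haa]
    rw [hq1]
    field_simp
  rw [ouGenerator, hd2, hd1]
  change ∫ y, deriv f (a * x + b * y) * (p' t + q' t * y) ∂γ = _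
  rw [hsplit, gauss_ibp hf2 hM' hM'' (a * x) b, ← mul_assoc, hqb]
  simp only [hp', ← ha]
  ring

end

end ReverseHeatFlow

open ReverseHeatFlow

namespace ReverseHeatFlow

open Filter Topology Set
open scoped NNReal ENNReal

/-! Write `u dγ = e^{-U} dx = ν`. The backward flow `e^{-tA} u` need not exist, but its Taylor
polynomial `T = ∑_{j<K} (-t)^j/j! A^j u` does, because `U` has `2K` derivatives. The quotients `r_j
= (A^j u)/u` (`adjIterate`) are polynomials in `x` and the derivatives of `U`, so they grow
polynomially, while subexponential decay bounds every moment of `ν`.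

Flowing `T` forward recovers `u` up to `O(t^K)` in `L¹(γ)`. Indeed, for a test function `φ` the
functions `G_j(s) = ∫ r_j e^{sA}φ dν` satisfy `G_j' = G_{j+1}`, and Taylor's formula for `G_0(0)`
around `t` leaves a remainder of at most `t^K ∫ |r_K| dν` (`abs_integral_backward_taylor_le`).
Symmetry of the semigroup and duality turn this into the `L¹` bound
(`integral_abs_ouSemigroup_sub_le`).

Since `T` may be negative, `T/u - 1` is cut off where it stops being of size `√t`; the discarded
tail is `O(t^K)` by the moment bounds. For `j ≥ 1` the moments of `A^j u` of order at most two
vanish, because `A` preserves polynomials of degree at most two and `ν` shares its first two moments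
with `γ`. So only the cutoff disturbs mass, mean and variance, and a small bounded function
supported in `[-1, 1]` repairs them (`exists_truncation`). The outcome is `g = u (1 + h)` with `|h|
≤ 1/3`.

The two measures then have density ratio in `[2/3, 4/3]`, an interval whose endpoints differ by a
factor 2, and Holley–Stroock (`LSI.of_comparable`) yields the factor 2 in the LSI. For the tensor
powers, replacing one factor at a time costs a factor `n` (`integral_abs_prod_sub_prod_le`).
Estimates are proved for families of potentials with common bounds, so that the constants depend on
those bounds only. -/

/-! ### Perturbation of logarithmic Sobolev inequalities -/

/-- The Holley–Stroock perturbation principle for comparable measures. -/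
lemma LSI.of_comparable {μ ν : Measure ℝ} [IsProbabilityMeasure μ] [IsProbabilityMeasure ν] {c : ℝ≥0}
    (hc : c ≠ 0) (h₁ : c • ν ≤ μ) (h₂ : μ ≤ (2 * c) • ν) {θ : ℝ} (h : LSI ν θ) :
    LSI μ (2 * θ) := by
  intro f hf hac hf1 hI
  have hc0 : (0 : ℝ) < c := by exact_mod_cast pos_iff_ne_zero.2 hc
  have down : ∀ {φ : ℝ → ℝ}, Integrable φ μ → Integrable φ ν := fun hφ =>
    (integrable_smul_measure (c := (c : ℝ≥0∞)) (by simpa using hc) (by simp)).1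
      (hφ.mono_measure h₁)
  have up : ∀ {φ : ℝ → ℝ}, Integrable φ ν → Integrable φ μ := fun hφ =>
    (hφ.smul_measure_nnreal (c := 2 * c)).mono_measure h₂
  have le_up : ∀ {φ : ℝ → ℝ}, (∀ x, 0 ≤ φ x) → Integrable φ ν →
      ∫ x, φ x ∂μ ≤ 2 * c * ∫ x, φ x ∂ν := fun {φ} h0 hφ => by
    have := integral_mono_measure h₂ (Eventually.of_forall h0) (hφ.smul_measure_nnreal (c := 2 * c))
    rw [integral_smul_nnreal_measure] at this
    simpa [NNReal.smul_def] using this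
  have le_down : ∀ {φ : ℝ → ℝ}, (∀ x, 0 ≤ φ x) → Integrable φ μ →
      c * ∫ x, φ x ∂ν ≤ ∫ x, φ x ∂μ := fun {φ} h0 hφ => by
    have := integral_mono_measure h₁ (Eventually.of_forall h0) hφ
    rw [integral_smul_nnreal_measure] at this
    simpa [NNReal.smul_def] using this
  -- The integral of a nonintegrable function is 0 by convention, so the normalization forces
  -- integrability.
  have hfμ : Integrable f μ := by
    by_contra hn
    rw [integral_undef hn] at hf1
    exact zero_ne_one hf1
  have hfν := down hfμ
  have hm : 0 < ∫ x, f x ∂ν := by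
    have := le_up hf hfν
    rw [hf1] at this
    by_contra hn
    nlinarith
  set m := ∫ x, f x ∂ν with hm_def
  have hsq : (fun y => √(f y / m)) = fun y => √(f y) / √m := by
    ext y; rw [Real.sqrt_div (hf y)]
  have hd : ∀ x, deriv (fun y => √(f y / m)) x ^ 2 = m⁻¹ * deriv (fun y => √(f y)) x ^ 2 := by
    intro x
    rw [hsq, deriv_div_const, div_pow, Real.sq_sqrt hm.le]
    ring
  obtain ⟨e1, e2⟩ := h (fun x => f x / m) (fun x => div_nonneg (hf x) hm.le)
    (fun a b => by
      rw [hsq]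
      simpa [div_eq_inv_mul] using (hac a b).const_mul (√m)⁻¹)
    (by rw [integral_div, ← hm_def, div_self hm.ne'])
    (by simp_rw [hd]; exact (down hI).const_mul _)
  simp_rw [hd, integral_const_mul] at e2
  have hlog : ∀ x, f x * Real.log (f x)
      = m * (f x / m * Real.log (f x / m)) + Real.log m * f x := by
    intro x
    rcases (hf x).eq_or_lt with h0 | h0
    · simp [← h0]
    · rw [Real.log_div h0.ne' hm.ne']
      field_simp
      ring
  have e1μ := up e1
  -- Entropy is not monotone in the measure, but `f log (f/m) - f + m` is a nonnegative integrand.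
  -- With `m = ∫ f dν` its `ν`-integral is the entropy under `ν`, while its `μ`-integral dominates
  -- the entropy under `μ` because `log m ≤ m - 1`.
  have hkl : ∀ x, m * InformationTheory.klFun (f x / m)
      = m * (f x / m * Real.log (f x / m)) + (m - f x) := by
    intro x
    rw [InformationTheory.klFun]
    field_simp
    ring
  have hkl0 : ∀ x, 0 ≤ m * InformationTheory.klFun (f x / m) := fun x =>
    mul_nonneg hm.le (InformationTheory.klFun_nonneg (div_nonneg (hf x) hm.le))
  have hklν : Integrable (fun x => m * InformationTheory.klFun (f x / m)) ν := by
    simp_rw [hkl]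
    exact (e1.const_mul m).add ((integrable_const m).sub hfν)
  refine ⟨by simp_rw [hlog]; exact (e1μ.const_mul m).add (hfμ.const_mul _), ?_⟩
  have k1 := le_up hkl0 hklν
  have k2 : ∫ x, m * InformationTheory.klFun (f x / m) ∂μ
      = m * ∫ x, f x / m * Real.log (f x / m) ∂μ + m - 1 := by
    simp_rw [hkl]
    have hS : Integrable (fun x => m - f x) μ := (integrable_const m).sub hfμ
    rw [integral_add (e1μ.const_mul m) hS,
      integral_sub (integrable_const m) hfμ, integral_const_mul, hf1]
    simp
    ring
  have k3 : ∫ x, m * InformationTheory.klFun (f x / m) ∂ν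
      = m * ∫ x, f x / m * Real.log (f x / m) ∂ν := by
    simp_rw [hkl]
    have hS : Integrable (fun x => m - f x) ν := (integrable_const m).sub hfν
    rw [integral_add (e1.const_mul m) hS,
      integral_sub (integrable_const m) hfν, integral_const_mul, ← hm_def]
    simp
  have k4 : ∫ x, f x * Real.log (f x) ∂μ
      = m * ∫ x, f x / m * Real.log (f x / m) ∂μ + Real.log m := by
    simp_rw [hlog]
    rw [integral_add (e1μ.const_mul m) (hfμ.const_mul _), integral_const_mul, integral_const_mul,
      hf1, mul_one]
  set I := ∫ x, deriv (fun y => √(f y)) x ^ 2 ∂ν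
  set J := ∫ x, deriv (fun y => √(f y)) x ^ 2 ∂μ
  have k5 : c * I ≤ J := le_down (fun x => sq_nonneg _) hI
  have k6 : J ≤ 2 * c * I := le_up (fun x => sq_nonneg _) (down hI)
  have k7 : ∫ x, m * InformationTheory.klFun (f x / m) ∂ν ≤ θ * I := by
    rw [k3]
    calc m * ∫ x, f x / m * Real.log (f x / m) ∂ν ≤ m * (θ * (m⁻¹ * I)) := by gcongr
      _ = θ * I := by field_simp
  have k8 : 0 ≤ θ * I := (integral_nonneg hkl0).trans k7
  have hI0 : 0 ≤ I := integral_nonneg fun x => sq_nonneg _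
  -- A negative `θ` is possible only if both energies vanish, since `0 ≤ θ * I`.
  have k9 : c * (θ * I) ≤ θ * J := by
    rcases le_or_gt 0 θ with hθ | hθ
    · calc c * (θ * I) = θ * (c * I) := by ring
        _ ≤ θ * J := by gcongr
    · have : I = 0 := by nlinarith
      have hJ : J = 0 := by
        rw [this, mul_zero] at k5 k6
        exact le_antisymm k6 k5
      simp [this, hJ]
  have k10 := Real.log_le_sub_one_of_pos hm
  rw [k4]
  nlinarith

/-! ### Symmetry of the Mehler semigroup -/

lemma mehler_sq_add_sq {t : ℝ} (ht : 0 ≤ t) :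
    Real.exp (-t / 2) ^ 2 + √(1 - Real.exp (-t)) ^ 2 = 1 := by
  rw [Real.sq_sqrt (by simpa using ht), ← Real.exp_nat_mul]
  have : ((2 : ℕ) : ℝ) * (-t / 2) = -t := by push_cast; ring
  rw [this]
  ring

/-- The product Gaussian is invariant under reflections of the plane. -/
lemma measurePreserving_reflection {a b : ℝ} (hab : a ^ 2 + b ^ 2 = 1) (ha : 0 ≤ a) (hb : 0 ≤ b) :
    MeasurePreserving (fun p : ℝ × ℝ => (a * p.1 + b * p.2, b * p.1 - a * p.2))
      (γ.prod γ) (γ.prod γ) := by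
  have hcos : Real.cos (Real.arccos a) = a := Real.cos_arccos (by linarith) (by nlinarith)
  have hsin : Real.sin (Real.arccos a) = b := by
    rw [Real.sin_arccos, ← hab, add_sub_cancel_left, Real.sqrt_sq hb]
  have hrot : MeasurePreserving (ContinuousLinearMap.rotation (E := ℝ) (Real.arccos a))
      (γ.prod γ) (γ.prod γ) :=
    ⟨by fun_prop, IsGaussian.map_rotation_eq_self (by simp) _⟩
  have hneg : MeasurePreserving (fun x : ℝ => -x) γ γ :=
    ⟨by fun_prop, by rw [gaussianReal_map_neg]; simp⟩
  -- The reflection is the rotation by `arccos a` followed by a sign change of the second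
  -- coordinate.
  convert ((MeasurePreserving.id γ).prod hneg).comp hrot using 1
  ext p
  · simp [ContinuousLinearMap.rotation_apply, hcos, hsin]
  · simp [ContinuousLinearMap.rotation_apply, hcos, hsin]
    ring

lemma integrable_mehler {f : ℝ → ℝ} (hf : Integrable f γ) {t : ℝ} (ht : 0 ≤ t) :
    Integrable (fun p : ℝ × ℝ => f (Real.exp (-t / 2) * p.1 + √(1 - Real.exp (-t)) * p.2))
      (γ.prod γ) :=
  (measurePreserving_reflection (mehler_sq_add_sq ht) (Real.exp_nonneg _)
    (Real.sqrt_nonneg _)).integrable_comp_of_integrable (g := fun p : ℝ × ℝ => f p.1)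
    (hf.comp_fst γ)

lemma integrable_ouSemigroup {f : ℝ → ℝ} (hf : Integrable f γ) {t : ℝ} (ht : 0 ≤ t) :
    Integrable (ouSemigroup γ t f) γ :=
  (integrable_mehler hf ht).integral_prod_left

/-- The Ornstein–Uhlenbeck semigroup is symmetric with respect to the Gaussian measure. -/
lemma integral_ouSemigroup_mul {f φ : ℝ → ℝ} (hf : Integrable f γ) (hφ : Measurable φ) {M : ℝ}
    (hM : ∀ x, |φ x| ≤ M) {t : ℝ} (ht : 0 ≤ t) :
    ∫ x, ouSemigroup γ t f x * φ x ∂γ = ∫ x, f x * ouSemigroup γ t φ x ∂γ := by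
  have hab := mehler_sq_add_sq ht
  have hR := measurePreserving_reflection hab (Real.exp_nonneg _) (Real.sqrt_nonneg _)
  have hi := integrable_mehler hf ht
  simp only [ouSemigroup, smul_eq_mul]
  set a := Real.exp (-t / 2)
  set b := √(1 - Real.exp (-t))
  have h1 : Integrable (fun p : ℝ × ℝ => f (a * p.1 + b * p.2) * φ p.1) (γ.prod γ) :=
    hi.mul_bdd (c := M) (hφ.comp measurable_fst).aestronglyMeasurable (Eventually.of_forall fun p => hM _)
  have h2 : Integrable (fun p : ℝ × ℝ => f p.1 * φ (a * p.1 + b * p.2)) (γ.prod γ) :=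
    (hf.comp_fst γ).mul_bdd (c := M)
      (hφ.comp (by fun_prop : Measurable fun p : ℝ × ℝ => a * p.1 + b * p.2)).aestronglyMeasurable (Eventually.of_forall fun p => hM _)
  simp_rw [← integral_mul_const, ← integral_const_mul]
  rw [← integral_prod (fun p : ℝ × ℝ => f (a * p.1 + b * p.2) * φ p.1) h1,
    ← integral_prod (fun p : ℝ × ℝ => f p.1 * φ (a * p.1 + b * p.2)) h2]
  -- The reflection is an involution exchanging `p.1` with `a * p.1 + b * p.2`, so this change of
  -- variables swaps the arguments of `f` and `φ`.
  conv_rhs => rw [← hR.map_eq]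
  rw [integral_map hR.measurable.aemeasurable (by rw [hR.map_eq]; exact h2.aestronglyMeasurable)]
  congr 1
  ext p
  have : a * (a * p.1 + b * p.2) + b * (b * p.1 - a * p.2) = p.1 := by
    linear_combination p.1 * hab
  simp only [this]

lemma integral_ouSemigroup {f : ℝ → ℝ} (hf : Integrable f γ) {t : ℝ} (ht : 0 ≤ t) :
    ∫ x, ouSemigroup γ t f x ∂γ = ∫ x, f x ∂γ := by
  have := integral_ouSemigroup_mul hf (φ := fun _ => 1) (M := 1) measurable_const (by simp) ht
  simpa [ouSemigroup] using this

lemma measurable_ouSemigroup {f : ℝ → ℝ} (hf : Measurable f) (t : ℝ) :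
    Measurable (ouSemigroup γ t f) := by
  have : StronglyMeasurable
      (fun p : ℝ × ℝ => f (Real.exp (-t / 2) • p.1 + √(1 - Real.exp (-t)) • p.2)) := by
    apply Measurable.stronglyMeasurable
    fun_prop
  exact this.integral_prod_right.measurable

/-! ### Probability densities and tensor powers -/

lemma IsProbDensity.integrable {g : ℝ → ℝ} (hg : IsProbDensity g) : Integrable g γ := by
  refine ⟨hg.measurable.aestronglyMeasurable, ?_⟩
  rw [hasFiniteIntegral_iff_ofReal (Eventually.of_forall hg.nonneg), hg.lintegral_eq_one]
  exact ENNReal.one_lt_top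

lemma IsProbDensity.integral_eq_one {g : ℝ → ℝ} (hg : IsProbDensity g) : ∫ x, g x ∂γ = 1 := by
  rw [integral_eq_lintegral_of_nonneg_ae (Eventually.of_forall hg.nonneg)
    hg.measurable.aestronglyMeasurable, hg.lintegral_eq_one, ENNReal.toReal_one]

/-- Hybrid argument: the difference of products telescopes into `n` terms, each with one factor `a -
b`, the factors `b` before it and `a` after it. By Fubini each term has norm `∫ |a - b|`, since the
other factors have integral one. -/
lemma integral_abs_prod_sub_prod_le {a b : ℝ → ℝ} (ha : Integrable a γ) (hb : Integrable b γ)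
    (ha0 : ∀ x, 0 ≤ a x) (hb0 : ∀ x, 0 ≤ b x) (ha1 : ∫ x, a x ∂γ = 1) (hb1 : ∫ x, b x ∂γ = 1)
    (n : ℕ) :
    ∫ x, |∏ i, a (x i) - ∏ i, b (x i)| ∂γn n ≤ n * ∫ x, |a x - b x| ∂γ := by
  let c : Fin n → Fin n → ℝ → ℝ := fun i j =>
    if j < i then b else if i < j then a else fun x => |a x - b x|
  have hc : ∀ i j, Integrable (c i j) γ := fun i j => by
    simp only [c]
    split_ifs
    exacts [hb, ha, (ha.sub hb).abs]
  have hcI : ∀ i, ∫ x, ∏ j, c i j (x j) ∂γn n = ∫ x, |a x - b x| ∂γ := fun i => by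
    rw [integral_fintype_prod_eq_prod (𝕜 := ℝ) (c i), Finset.prod_eq_single i]
    · simp [c]
    · intro j _ hj
      rcases lt_or_gt_of_ne hj with h | h
      · simp [c, h, hb1]
      · simp [c, h, h.not_gt, ha1]
    · simp
  have key : ∀ x : Fin n → ℝ, |∏ i, a (x i) - ∏ i, b (x i)| ≤ ∑ i, ∏ j, c i j (x j) := fun x => by
    have h := Finset.prod_sub_ordered Finset.univ (fun i => a (x i)) (fun i => a (x i) - b (x i))
    simp only [sub_sub_cancel] at h
    rw [h, sub_sub_cancel]
    refine (Finset.abs_sum_le_sum_abs _ _).trans (Finset.sum_le_sum fun i _ => le_of_eq ?_)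
    have e1 : ∀ j, c i j (x j) = (if j = i then |a (x i) - b (x i)| else 1) *
        (if j < i then b (x j) else 1) * (if i < j then a (x j) else 1) := fun j => by
      rcases lt_trichotomy j i with h | h | h
      · simp [c, h, h.ne, h.not_gt]
      · simp [c, h]
      · simp [c, h, h.ne', h.not_gt]
    simp_rw [e1, Finset.prod_mul_distrib, Finset.prod_ite_eq' Finset.univ i, Finset.mem_univ,
      if_true, ← Finset.prod_filter]
    rw [abs_mul, abs_mul, abs_of_nonneg (Finset.prod_nonneg fun j _ => hb0 _),
      abs_of_nonneg (Finset.prod_nonneg fun j _ => ha0 _)]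
  have hint : ∀ i, Integrable (fun x : Fin n → ℝ => ∏ j, c i j (x j)) (γn n) := fun i =>
    Integrable.fintype_prod (hc i)
  calc ∫ x, |∏ i, a (x i) - ∏ i, b (x i)| ∂γn n ≤ ∫ x, ∑ i, ∏ j, c i j (x j) ∂γn n :=
        integral_mono_of_nonneg (Eventually.of_forall fun _ => abs_nonneg _)
          (integrable_finsetSum _ fun i _ => hint i) (Eventually.of_forall key)
    _ = n * ∫ x, |a x - b x| ∂γ := by
        rw [integral_finsetSum _ fun i _ => hint i]
        simp [hcI]

lemma ouSemigroup_tensorPow (n : ℕ) (t : ℝ) (g : ℝ → ℝ) (x : Fin n → ℝ) :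
    ouSemigroup (γn n) t (tensorPow n g) x = ∏ i, ouSemigroup γ t g (x i) := by
  simp only [ouSemigroup, tensorPow, Pi.add_apply, Pi.smul_apply]
  exact integral_fintype_prod_eq_prod (𝕜 := ℝ)
    (fun i y => g (Real.exp (-t / 2) • x i + √(1 - Real.exp (-t)) • y))

lemma eLpNorm_one_eq_ofReal_integral_abs {α : Type*} [MeasurableSpace α] {μ : Measure α}
    {f : α → ℝ} (hf : Integrable f μ) : eLpNorm f 1 μ = ENNReal.ofReal (∫ x, |f x| ∂μ) := by
  rw [eLpNorm_one_eq_lintegral_enorm, ← ofReal_integral_norm_eq_lintegral_enorm hf]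
  rfl

lemma integral_abs_tensorPow_le {g u : ℝ → ℝ} (hg : IsProbDensity g) (hu : IsProbDensity u)
    {t : ℝ} (ht : 0 ≤ t) (n : ℕ) {ε : ℝ} (h : ∫ x, |ouSemigroup γ t g x - u x| ∂γ ≤ ε) :
    eLpNorm (fun x => ouSemigroup (γn n) t (tensorPow n g) x - tensorPow n u x) 1 (γn n)
      ≤ ENNReal.ofReal (n * ε) := by
  have hP := integrable_ouSemigroup hg.integrable ht
  have hi : Integrable (fun x => ouSemigroup (γn n) t (tensorPow n g) x - tensorPow n u x)
      (γn n) := by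
    simp_rw [ouSemigroup_tensorPow]
    exact (Integrable.fintype_prod fun _ => hP).sub (Integrable.fintype_prod fun _ => hu.integrable)
  rw [eLpNorm_one_eq_ofReal_integral_abs hi]
  refine ENNReal.ofReal_le_ofReal ?_
  simp_rw [ouSemigroup_tensorPow]
  refine (integral_abs_prod_sub_prod_le hP hu.integrable
    (fun x => integral_nonneg fun y => hg.nonneg _) hu.nonneg ?_ hu.integral_eq_one n).trans ?_
  · rw [integral_ouSemigroup hg.integrable ht, hg.integral_eq_one]
  · gcongr

/-! ### Duality for the `L¹` norm -/

open scoped Convolution in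
/-- The `L¹` norm is recovered by testing against smooth functions bounded by one. -/
lemma integral_abs_le_of_forall_contDiff {H : ℝ → ℝ} (hHm : Measurable H) (hH : Integrable H γ)
    {M : ℝ} (h : ∀ φ : ℝ → ℝ, ContDiff ℝ 2 φ → HasCompactSupport φ → (∀ x, |φ x| ≤ 1) →
      ∫ x, H x * φ x ∂γ ≤ M) :
    ∫ x, |H x| ∂γ ≤ M := by
  -- Test functions approximating `sign H`: cut off to `[-n, n]`, then mollify. The fixed radius
  -- ratio 2 is what almost everywhere convergence of the mollifications requires; first `k → ∞`,
  -- then `n → ∞`.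
  let bump : ℕ → ContDiffBump (0 : ℝ) := fun k =>
    ⟨1 / ((k : ℝ) + 1), 2 * (1 / ((k : ℝ) + 1)), by positivity, by
      have : 0 < 1 / ((k : ℝ) + 1) := by positivity
      linarith⟩
  let s : ℕ → ℝ → ℝ := fun n => (Icc (-(n : ℝ)) n).indicator (fun x => (SignType.sign (H x) : ℝ))
  have hs1 : ∀ n x, |s n x| ≤ 1 := fun n x => by
    simp only [s, indicator]
    split_ifs
    · rcases lt_trichotomy (H x) 0 with h | h | h <;> simp [h]
    · simp
  have hsm : ∀ n, Measurable (s n) := fun n => by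
    refine Measurable.indicator ?_ measurableSet_Icc
    have : (fun x => (SignType.sign (H x) : ℝ))
        = fun x => if 0 < H x then 1 else if H x < 0 then -1 else 0 := by
      ext x
      rcases lt_trichotomy (H x) 0 with h | h | h <;> simp [h, h.not_gt]
    rw [this]
    exact Measurable.ite (measurableSet_lt measurable_const hHm) measurable_const
      (Measurable.ite (measurableSet_lt hHm measurable_const) measurable_const measurable_const)
  have hsl : ∀ n, LocallyIntegrable (s n) volume := fun n =>
    (locallyIntegrable_const (1 : ℝ)).mono (hsm n).aestronglyMeasurable
      (Eventually.of_forall fun x => by simpa using hs1 n x)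
  have hsc : ∀ n, HasCompactSupport (s n) := fun n =>
    HasCompactSupport.intro (isCompact_Icc (a := -(n : ℝ)) (b := n)) fun x hx =>
      indicator_of_notMem hx _
  let ψ : ℕ → ℕ → ℝ → ℝ := fun n k =>
    ((bump k).normed volume ⋆[ContinuousLinearMap.lsmul ℝ ℝ, volume] s n)
  have hψ1 : ∀ n k x, |ψ n k x| ≤ 1 := fun n k x => by
    have : ‖ψ n k x‖ ≤ ∫ y, (bump k).normed volume y := by
      refine norm_integral_le_of_norm_le (bump k).integrable_normed
        (Eventually.of_forall fun y => ?_)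
      simp only [ContinuousLinearMap.lsmul_apply, smul_eq_mul, norm_mul, Real.norm_eq_abs]
      rw [abs_of_nonneg ((bump k).nonneg_normed y)]
      exact mul_le_of_le_one_right ((bump k).nonneg_normed y) (hs1 _ _)
    rwa [(bump k).integral_normed] at this
  have hψM : ∀ n k, ∫ x, H x * ψ n k x ∂γ ≤ M := fun n k => by
    refine h _ ?_ ?_ (hψ1 n k)
    · exact (bump k).hasCompactSupport_normed.contDiff_convolution_left _
        (bump k).contDiff_normed (hsl n)
    · exact (bump k).hasCompactSupport_normed.convolution _ (hsc n)
  have hr : Tendsto (fun k : ℕ => (bump k).rOut) atTop (𝓝 0) := by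
    have := (tendsto_one_div_add_atTop_nhds_zero_nat (𝕜 := ℝ)).const_mul 2
    rwa [mul_zero] at this
  have hsM : ∀ n, ∫ x, H x * s n x ∂γ ≤ M := fun n => by
    have hae : ∀ᵐ x ∂γ, Tendsto (fun k => ψ n k x) atTop (𝓝 (s n x)) :=
      (gaussianReal_absolutelyContinuous 0 one_ne_zero).ae_le
        (ContDiffBump.ae_convolution_tendsto_right_of_locallyIntegrable (K := 2) hr
          (Eventually.of_forall fun k => le_rfl) (hsl n))
    have := tendsto_integral_of_dominated_convergence (μ := γ) (F := fun k x => H x * ψ n k x)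
      (f := fun x => H x * s n x) (fun x => |H x|)
      (fun k => ((hHm.aestronglyMeasurable).mul
        ((bump k).hasCompactSupport_normed.continuous_convolution_left _
          (bump k).continuous_normed (hsl n)).aestronglyMeasurable))
      hH.abs (fun k => Eventually.of_forall fun x => by
        rw [norm_mul]; exact mul_le_of_le_one_right (abs_nonneg _) (hψ1 n k x))
      (hae.mono fun x hx => hx.const_mul _)
    exact le_of_tendsto' this fun k => hψM n k
  have hlim := tendsto_integral_of_dominated_convergence (μ := γ) (F := fun n x => H x * s n x)
      (f := fun x => |H x|) (fun x => |H x|)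
      (fun n => (hHm.mul (hsm n)).aestronglyMeasurable)
      hH.abs (fun n => Eventually.of_forall fun x => by
        rw [norm_mul]; exact mul_le_of_le_one_right (abs_nonneg _) (hs1 n x))
      (Eventually.of_forall fun x => by
        refine tendsto_const_nhds.congr' ?_
        filter_upwards [eventually_ge_atTop ⌈|x|⌉₊] with n hn
        have hx : x ∈ Icc (-(n : ℝ)) n := abs_le.1 (Nat.ceil_le.1 hn)
        simp only [s, indicator_of_mem hx]
        exact (self_mul_sign _).symm)
  exact le_of_tendsto' hlim hsM

/-! ### Uniform polynomial growth -/

/-- A family of functions on `ℝ` with a common polynomial bound. -/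
def PolyGrowth {ι : Type*} (f : ι → ℝ → ℝ) : Prop :=
  ∃ (B : ℝ) (D : ℕ), ∀ i x, |f i x| ≤ B * (1 + x ^ 2) ^ D

/-- A family of `C^k` functions on `ℝ` whose derivatives up to order `k` have common polynomial
bounds. -/
def SmoothPolyGrowth {ι : Type*} : ℕ → (ι → ℝ → ℝ) → Prop
  | 0, f => (∀ i, Continuous (f i)) ∧ PolyGrowth f
  | k + 1, f => (∀ i, Differentiable ℝ (f i)) ∧ PolyGrowth f ∧
      SmoothPolyGrowth k (fun i => deriv (f i))

section Growth

variable {ι : Type*} {f g : ι → ℝ → ℝ} {k : ℕ}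

lemma PolyGrowth.exists_nonneg (hf : PolyGrowth f) :
    ∃ (B : ℝ) (D : ℕ), 0 ≤ B ∧ ∀ i x, |f i x| ≤ B * (1 + x ^ 2) ^ D := by
  obtain ⟨B, D, h⟩ := hf
  exact ⟨|B|, D, abs_nonneg B, fun i x => (h i x).trans (by gcongr; exact le_abs_self B)⟩

lemma one_le_one_add_sq (x : ℝ) : 1 ≤ 1 + x ^ 2 := by nlinarith [sq_nonneg x]

lemma PolyGrowth.add (hf : PolyGrowth f) (hg : PolyGrowth g) :
    PolyGrowth (fun i x => f i x + g i x) := by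
  obtain ⟨B, D, hB, h⟩ := hf.exists_nonneg
  obtain ⟨B', D', hB', h'⟩ := hg.exists_nonneg
  refine ⟨B + B', D + D', fun i x => (abs_add_le _ _).trans ?_⟩
  have h1 : (1 + x ^ 2) ^ D ≤ (1 + x ^ 2) ^ (D + D') :=
    pow_le_pow_right₀ (one_le_one_add_sq x) (by omega)
  have h2 : (1 + x ^ 2) ^ D' ≤ (1 + x ^ 2) ^ (D + D') :=
    pow_le_pow_right₀ (one_le_one_add_sq x) (by omega)
  calc |f i x| + |g i x| ≤ B * (1 + x ^ 2) ^ D + B' * (1 + x ^ 2) ^ D' := add_le_add (h i x) (h' i x)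
    _ ≤ B * (1 + x ^ 2) ^ (D + D') + B' * (1 + x ^ 2) ^ (D + D') := by gcongr
    _ = _ := by ring

lemma PolyGrowth.mul (hf : PolyGrowth f) (hg : PolyGrowth g) :
    PolyGrowth (fun i x => f i x * g i x) := by
  obtain ⟨B, D, hB, h⟩ := hf.exists_nonneg
  obtain ⟨B', D', hB', h'⟩ := hg.exists_nonneg
  refine ⟨B * B', D + D', fun i x => ?_⟩
  rw [abs_mul]
  calc |f i x| * |g i x| ≤ (B * (1 + x ^ 2) ^ D) * (B' * (1 + x ^ 2) ^ D') := by
        gcongr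
        exacts [h i x, h' i x]
    _ = _ := by ring

lemma PolyGrowth.of_bounded {M : ℝ} (h : ∀ i x, |f i x| ≤ M) : PolyGrowth f :=
  ⟨M, 0, fun i x => by simpa using h i x⟩

lemma PolyGrowth.mono (hg : PolyGrowth g) (h : ∀ i x, |f i x| ≤ |g i x|) : PolyGrowth f :=
  let ⟨B, D, hB⟩ := hg
  ⟨B, D, fun i x => (h i x).trans (hB i x)⟩

lemma PolyGrowth.id : PolyGrowth (fun (_ : ι) x => x) :=
  ⟨1, 1, fun _ x => by rw [one_mul, pow_one, abs_le]; constructor <;> nlinarith [sq_nonneg (x + 1), sq_nonneg (x - 1)]⟩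

lemma SmoothPolyGrowth.polyGrowth (hf : SmoothPolyGrowth k f) : PolyGrowth f := by
  cases k with
  | zero => exact hf.2
  | succ k => exact hf.2.1

lemma SmoothPolyGrowth.continuous (hf : SmoothPolyGrowth k f) (i : ι) : Continuous (f i) := by
  cases k with
  | zero => exact hf.1 i
  | succ k => exact (hf.1 i).continuous

lemma SmoothPolyGrowth.deriv (hf : SmoothPolyGrowth (k + 1) f) :
    SmoothPolyGrowth k (fun i => deriv (f i)) := hf.2.2

lemma SmoothPolyGrowth.hasDerivAt (hf : SmoothPolyGrowth (k + 1) f) (i : ι) (x : ℝ) :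
    HasDerivAt (f i) (_root_.deriv (f i) x) x := (hf.1 i x).hasDerivAt

lemma SmoothPolyGrowth.of_succ (hf : SmoothPolyGrowth (k + 1) f) : SmoothPolyGrowth k f := by
  induction k generalizing f with
  | zero => exact ⟨hf.continuous, hf.polyGrowth⟩
  | succ k ih => exact ⟨hf.1, hf.2.1, ih hf.2.2⟩

lemma SmoothPolyGrowth.of_le {m : ℕ} (hf : SmoothPolyGrowth m f) (h : k ≤ m) :
    SmoothPolyGrowth k f := by
  induction m, h using Nat.le_induction with
  | base => exact hf
  | succ m _ ih => exact ih hf.of_succ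

lemma SmoothPolyGrowth.add (hf : SmoothPolyGrowth k f) (hg : SmoothPolyGrowth k g) :
    SmoothPolyGrowth k (fun i x => f i x + g i x) := by
  induction k generalizing f g with
  | zero => exact ⟨fun i => (hf.1 i).add (hg.1 i), hf.2.add hg.2⟩
  | succ k ih =>
    refine ⟨fun i => (hf.1 i).add (hg.1 i), hf.2.1.add hg.2.1, ?_⟩
    convert ih hf.2.2 hg.2.2 using 3 with i x
    exact ((hf.hasDerivAt i x).add (hg.hasDerivAt i x)).deriv

lemma SmoothPolyGrowth.mul (hf : SmoothPolyGrowth k f) (hg : SmoothPolyGrowth k g) :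
    SmoothPolyGrowth k (fun i x => f i x * g i x) := by
  induction k generalizing f g with
  | zero => exact ⟨fun i => (hf.1 i).mul (hg.1 i), hf.2.mul hg.2⟩
  | succ k ih =>
    refine ⟨fun i => (hf.1 i).mul (hg.1 i), hf.2.1.mul hg.2.1, ?_⟩
    convert (ih hf.2.2 hg.of_succ).add (ih hf.of_succ hg.2.2) using 3 with i x
    exact ((hf.hasDerivAt i x).mul (hg.hasDerivAt i x)).deriv

lemma SmoothPolyGrowth.const (c : ℝ) : SmoothPolyGrowth k (fun (_ : ι) _ => c) := by
  induction k generalizing c with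
  | zero => exact ⟨fun _ => continuous_const, .of_bounded fun _ _ => le_rfl⟩
  | succ k ih =>
    refine ⟨fun _ => differentiable_const c, .of_bounded fun _ _ => le_rfl, ?_⟩
    simpa using ih 0

lemma SmoothPolyGrowth.id : SmoothPolyGrowth k (fun (_ : ι) x => x) := by
  cases k with
  | zero => exact ⟨fun _ => continuous_id, .id⟩
  | succ k =>
    refine ⟨fun _ => differentiable_id, .id, ?_⟩
    simpa using SmoothPolyGrowth.const 1

lemma SmoothPolyGrowth.sub (hf : SmoothPolyGrowth k f) (hg : SmoothPolyGrowth k g) :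
    SmoothPolyGrowth k (fun i x => f i x - g i x) := by
  simpa [sub_eq_add_neg] using hf.add ((SmoothPolyGrowth.const (-1)).mul hg)

lemma SmoothPolyGrowth.of_iteratedDeriv {m : ℕ} (hf : ∀ i, ContDiff ℝ m (f i))
    (hb : ∀ j ≤ m, PolyGrowth (fun i => iteratedDeriv j (f i))) : SmoothPolyGrowth m f := by
  induction m generalizing f with
  | zero => exact ⟨fun i => (hf i).continuous, by simpa using hb 0 le_rfl⟩
  | succ m ih =>
    refine ⟨fun i => (hf i).differentiable (by simp), by simpa using hb 0 (by omega),
      ih (fun i => ?_) fun j hj => ?_⟩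
    · have := hf i
      push_cast at this
      exact (contDiff_succ_iff_deriv.1 this).2.2
    · simpa [iteratedDeriv_succ'] using hb (j + 1) (by omega)

end Growth

/-! ### Uniform moment bounds -/

/-- A family of measures on `ℝ` whose moments are bounded uniformly. -/
def UniformMoments {ι : Type*} (ν : ι → Measure ℝ) : Prop :=
  ∀ p : ℕ, ∃ M : ℝ, ∀ i, Integrable (fun x : ℝ => (1 + x ^ 2) ^ p) (ν i) ∧
    ∫ x, (1 + x ^ 2) ^ p ∂ν i ≤ M

section Moments

variable {ι : Type*} {f : ι → ℝ → ℝ} {ν : ι → Measure ℝ}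

lemma UniformMoments.integrable (hν : UniformMoments ν) (hf : PolyGrowth f)
    (hm : ∀ i, Measurable (f i)) (i : ι) : Integrable (f i) (ν i) := by
  obtain ⟨B, D, h⟩ := hf
  obtain ⟨M, hM⟩ := hν D
  exact ((hM i).1.const_mul B).mono' (hm i).aestronglyMeasurable
    (Eventually.of_forall fun x => h i x)

lemma UniformMoments.integral_le (hν : UniformMoments ν) (hf : PolyGrowth f) :
    ∃ M, 0 ≤ M ∧ ∀ i, ∫ x, |f i x| ∂ν i ≤ M := by
  obtain ⟨B, D, hB, h⟩ := hf.exists_nonneg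
  obtain ⟨M, hM⟩ := hν D
  refine ⟨B * |M|, by positivity, fun i => ?_⟩
  calc ∫ x, |f i x| ∂ν i ≤ ∫ x, B * (1 + x ^ 2) ^ D ∂ν i :=
        integral_mono_of_nonneg (Eventually.of_forall fun _ => abs_nonneg _)
          ((hM i).1.const_mul B) (Eventually.of_forall fun x => h i x)
    _ ≤ B * |M| := by
        rw [integral_const_mul]
        gcongr
        exact (hM i).2.trans (le_abs_self M)

end Moments

/-- By the layer-cake formula the moment of order `2p` is at most `2p |C₀| ∫ y^(2p-1) exp(-y^q) dy`,
which depends on `ν` only through `C₀` and `q`. -/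
lemma exists_moment_le (C₀ : ℝ) {q : ℝ} (hq : 0 < q) (p : ℕ) :
    ∃ M : ℝ, ∀ ν : Measure ℝ, IsProbabilityMeasure ν → SubexpDecay ν C₀ q →
      Integrable (fun x : ℝ => (1 + x ^ 2) ^ p) ν ∧ ∫ x, (1 + x ^ 2) ^ p ∂ν ≤ M := by
  rcases Nat.eq_zero_or_pos p with rfl | hp
  · exact ⟨1, fun ν _ _ => by simp⟩
  set s : ℝ := ((2 * p : ℕ) : ℝ) with hs
  have hs0 : 0 < s := by rw [hs]; exact_mod_cast (by omega : 0 < 2 * p)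
  set L : ℝ := |C₀| * ∫ y in Ioi 0, y ^ (s - 1) * Real.exp (-y ^ q)
  have hL0 : 0 ≤ L := mul_nonneg (abs_nonneg _) (setIntegral_nonneg measurableSet_Ioi
    fun y hy => mul_nonneg (Real.rpow_nonneg (le_of_lt hy) _) (Real.exp_nonneg _))
  refine ⟨2 ^ (p - 1) * (1 + s * L), fun ν _ hν => ?_⟩
  have h1 : ∫⁻ x, ENNReal.ofReal (|x| ^ s) ∂ν ≤ ENNReal.ofReal (s * L) := by
    rw [lintegral_rpow_eq_lintegral_meas_le_mul ν (Eventually.of_forall fun x => abs_nonneg x)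
      (by fun_prop) hs0, ENNReal.ofReal_mul hs0.le]
    gcongr
    have hi := integrableOn_rpow_mul_exp_neg_rpow (s := s - 1) (by linarith) hq
    simp only [L]
    rw [← integral_const_mul, ofReal_integral_eq_lintegral_ofReal (hi.const_mul _)]
    · refine setLIntegral_mono' measurableSet_Ioi fun y hy => ?_
      have hy0 : 0 ≤ y := le_of_lt hy
      rw [← ofReal_measureReal, ← ENNReal.ofReal_mul measureReal_nonneg]
      refine ENNReal.ofReal_le_ofReal ?_
      calc ν.real {a | y ≤ |a|} * y ^ (s - 1)
          ≤ (|C₀| * Real.exp (-y ^ q)) * y ^ (s - 1) := by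
            gcongr
            exact (hν y hy0).trans (by gcongr; exact le_abs_self _)
        _ = _ := by ring
    · filter_upwards [self_mem_ae_restrict measurableSet_Ioi] with y hy
      have hy0 : 0 ≤ y := le_of_lt hy
      positivity
  have hpow : ∀ x : ℝ, |x| ^ s = x ^ (2 * p) := fun x => by
    rw [hs, Real.rpow_natCast, pow_mul, sq_abs, ← pow_mul]
  simp_rw [hpow] at h1
  have h0 : ∀ x : ℝ, 0 ≤ x ^ (2 * p) := fun x => by rw [pow_mul]; positivity
  have hint : Integrable (fun x : ℝ => x ^ (2 * p)) ν := by
    refine ⟨by fun_prop, ?_⟩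
    rw [hasFiniteIntegral_iff_ofReal (Eventually.of_forall h0)]
    exact h1.trans_lt ENNReal.ofReal_lt_top
  have h2 : ∫ x, x ^ (2 * p) ∂ν ≤ s * L := by
    rw [integral_eq_lintegral_of_nonneg_ae (Eventually.of_forall h0) (by fun_prop)]
    exact ENNReal.toReal_le_of_le_ofReal (by positivity) h1
  have hle : ∀ x : ℝ, (1 + x ^ 2) ^ p ≤ 2 ^ (p - 1) * (1 + x ^ (2 * p)) := fun x => by
    have := add_pow_le (zero_le_one (α := ℝ)) (sq_nonneg x) p
    rwa [one_pow, ← pow_mul] at this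
  have hint' : Integrable (fun x : ℝ => 2 ^ (p - 1) * (1 + x ^ (2 * p))) ν :=
    ((integrable_const 1).add hint).const_mul _
  refine ⟨hint'.mono' (by fun_prop) (Eventually.of_forall fun x => ?_), ?_⟩
  · rw [Real.norm_eq_abs, abs_of_nonneg (by positivity)]
    exact hle x
  · refine (integral_mono_of_nonneg (Eventually.of_forall fun x => by positivity) hint'
      (Eventually.of_forall hle)).trans ?_
    rw [integral_const_mul, integral_add (integrable_const 1) hint]
    simp only [integral_const, probReal_univ, smul_eq_mul, mul_one]
    gcongr

/-! ### The adjoint generator and its iterates -/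

/-- The measure with Lebesgue density `exp(-U)`. -/
noncomputable def gibbs (U : ℝ → ℝ) : Measure ℝ :=
  volume.withDensity (fun x => ENNReal.ofReal (Real.exp (-U x)))

lemma integral_gibbs {U : ℝ → ℝ} (hU : Measurable U) (f : ℝ → ℝ) :
    ∫ x, f x ∂gibbs U = ∫ x, Real.exp (-U x) * f x := by
  rw [gibbs, integral_withDensity_eq_integral_toReal_smul (by fun_prop) (by simp)]
  simp [ENNReal.toReal_ofReal, Real.exp_nonneg]

lemma integrable_gibbs_iff {U : ℝ → ℝ} (hU : Measurable U) {f : ℝ → ℝ} :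
    Integrable f (gibbs U) ↔ Integrable (fun x => Real.exp (-U x) * f x) := by
  rw [gibbs, integrable_withDensity_iff_integrable_smul' (by fun_prop) (by simp)]
  simp [ENNReal.toReal_ofReal, Real.exp_nonneg]

/-- The weighted derivative `e^U (e^{-U} s)'`. -/
noncomputable def weightedDeriv (U s : ℝ → ℝ) (x : ℝ) : ℝ := deriv s x - deriv U x * s x

/-- The adjoint of the Ornstein–Uhlenbeck generator in `L²(e^{-U} dx)`. -/
noncomputable def adjGenerator (U r : ℝ → ℝ) : ℝ → ℝ :=
  weightedDeriv U (fun x => 1 / 2 * (weightedDeriv U r x + x * r x))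

/-- The iterates of `adjGenerator`, applied to the constant function `1`. For `u dγ = e^{-U} dx` the
`j`-th one is `(A^j u) / u`. -/
noncomputable def adjIterate (U : ℝ → ℝ) : ℕ → ℝ → ℝ
  | 0 => fun _ => 1
  | j + 1 => adjGenerator U (adjIterate U j)

section Families

variable {ι : Type*} {U r s ψ : ι → ℝ → ℝ} {k : ℕ}

lemma SmoothPolyGrowth.weightedDeriv (hU : SmoothPolyGrowth (k + 1) U)
    (hs : SmoothPolyGrowth (k + 1) s) :
    SmoothPolyGrowth k (fun i => weightedDeriv (U i) (s i)) :=
  hs.deriv.sub (hU.deriv.mul hs.of_succ)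

lemma SmoothPolyGrowth.flux (hU : SmoothPolyGrowth (k + 1) U) (hr : SmoothPolyGrowth (k + 1) r) :
    SmoothPolyGrowth k
      (fun i x => 1 / 2 * (ReverseHeatFlow.weightedDeriv (U i) (r i) x + x * r i x)) :=
  (SmoothPolyGrowth.const _).mul ((hU.weightedDeriv hr).add (SmoothPolyGrowth.id.mul hr.of_succ))

lemma SmoothPolyGrowth.adjGenerator (hU : SmoothPolyGrowth (k + 2) U)
    (hr : SmoothPolyGrowth (k + 2) r) :
    SmoothPolyGrowth k (fun i => adjGenerator (U i) (r i)) :=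
  hU.of_succ.weightedDeriv (hU.flux hr)

/-- Each application of the second-order adjoint costs two derivatives of `U`; this is the origin of
the regularity order `2K`. -/
lemma SmoothPolyGrowth.adjIterate {j : ℕ} (hU : SmoothPolyGrowth (k + 2 * j) U) :
    SmoothPolyGrowth k (fun i => adjIterate (U i) j) := by
  induction j generalizing k with
  | zero => exact SmoothPolyGrowth.const 1
  | succ j ih =>
    exact (hU.of_le (by omega)).adjGenerator (ih (hU.of_le (by omega)))

/-- Integration by parts on the line. There are no boundary terms because polynomial growth and
finite moments make all the products integrable. -/
lemma integral_weightedDeriv_mul (hν : UniformMoments fun i => gibbs (U i))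
    (hU : SmoothPolyGrowth 1 U) (hs : SmoothPolyGrowth 1 s) (hψ : SmoothPolyGrowth 1 ψ) (i : ι) :
    ∫ x, weightedDeriv (U i) (s i) x * ψ i x ∂gibbs (U i)
      = -∫ x, s i x * deriv (ψ i) x ∂gibbs (U i) := by
  have hUm := (hU.continuous i).measurable
  have hint : ∀ {f : ι → ℝ → ℝ}, SmoothPolyGrowth 0 f →
      Integrable (fun x => Real.exp (-U i x) * f i x) := fun hf =>
    (integrable_gibbs_iff hUm).1 (hν.integrable hf.polyGrowth (fun i => (hf.continuous i).measurable) i)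
  rw [integral_gibbs hUm, integral_gibbs hUm]
  have h1 : ∀ x, HasDerivAt (fun x => Real.exp (-U i x) * s i x)
      (Real.exp (-U i x) * weightedDeriv (U i) (s i) x) x := fun x => by
    refine ((hU.hasDerivAt i x).neg.exp.mul (hs.hasDerivAt i x)).congr_deriv ?_
    simp only [Pi.neg_apply, weightedDeriv]
    ring
  have := integral_mul_deriv_eq_deriv_mul_of_integrable (u := fun x => Real.exp (-U i x) * s i x)
    (v := ψ i) (fun x _ => h1 x) (fun x _ => hψ.hasDerivAt i x)
    ((hint (hs.of_succ.mul hψ.deriv)).congr (Eventually.of_forall fun x => by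
      simp only [Pi.mul_apply]; ring))
    ((hint ((hU.weightedDeriv hs).mul hψ.of_succ)).congr (Eventually.of_forall fun x => by
      simp only [Pi.mul_apply]; ring))
    ((hint (hs.of_succ.mul hψ.of_succ)).congr (Eventually.of_forall fun x => by
      simp only [Pi.mul_apply]; ring))
  simp_rw [← mul_assoc]
  rw [this, neg_neg]

/-- The adjoint is in divergence form, `½ (ρ' + xρ)'` for `ρ = r e^{-U}`; two integrations by parts
move the derivatives onto `ψ`. -/
lemma integral_adjGenerator_mul (hν : UniformMoments fun i => gibbs (U i))
    (hU : SmoothPolyGrowth 2 U) (hr : SmoothPolyGrowth 2 r) (hψ : SmoothPolyGrowth 2 ψ) (i : ι) :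
    ∫ x, adjGenerator (U i) (r i) x * ψ i x ∂gibbs (U i)
      = ∫ x, r i x * ouGenerator (ψ i) x ∂gibbs (U i) := by
  have hint : ∀ {f : ι → ℝ → ℝ}, SmoothPolyGrowth 0 f → Integrable (f i) (gibbs (U i)) := fun hf =>
    hν.integrable hf.polyGrowth (fun i => (hf.continuous i).measurable) i
  have hU1 : SmoothPolyGrowth 1 U := hU.of_le (by norm_num)
  have hr1 : SmoothPolyGrowth 1 r := hr.of_le (by norm_num)
  have hr0 : SmoothPolyGrowth 0 r := hr.of_le (by norm_num)
  have hψ1 : SmoothPolyGrowth 1 ψ := hψ.of_le (by norm_num)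
  have hψ' : SmoothPolyGrowth 1 (fun i => deriv (ψ i)) := SmoothPolyGrowth.deriv (k := 1) hψ
  have hψ'0 : SmoothPolyGrowth 0 (fun i => deriv (ψ i)) := hψ'.of_le (by norm_num)
  have hflux := SmoothPolyGrowth.flux (k := 1) hU hr
  have e1 := integral_weightedDeriv_mul hν hU1 hflux hψ1 i
  have e2 := integral_weightedDeriv_mul hν hU1 hr1 hψ' i
  have hw : SmoothPolyGrowth 0 (fun i => weightedDeriv (U i) (r i)) :=
    SmoothPolyGrowth.weightedDeriv (k := 0) hU1 hr1
  have hxr : SmoothPolyGrowth 0 (fun i x => x * r i x) :=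
    (SmoothPolyGrowth.id (ι := ι) (k := 0)).mul hr0
  have i1 : Integrable (fun x => weightedDeriv (U i) (r i) x * deriv (ψ i) x) (gibbs (U i)) := by
    simpa using hint (hw.mul hψ'0)
  have i2 : Integrable (fun x => x * r i x * deriv (ψ i) x) (gibbs (U i)) := by
    simpa using hint (hxr.mul hψ'0)
  have i3 : Integrable (fun x => r i x * deriv (deriv (ψ i)) x) (gibbs (U i)) := by
    simpa using hint (hr0.mul (SmoothPolyGrowth.deriv (k := 0) hψ'))
  rw [adjGenerator, e1]
  calc -∫ x, 1 / 2 * (weightedDeriv (U i) (r i) x + x * r i x) * deriv (ψ i) x ∂gibbs (U i)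
      = -(1 / 2) * (∫ x, weightedDeriv (U i) (r i) x * deriv (ψ i) x ∂gibbs (U i)
          + ∫ x, x * r i x * deriv (ψ i) x ∂gibbs (U i)) := by
        rw [← integral_add i1 i2, ← integral_const_mul, ← integral_neg]
        congr 1; ext x; ring
    _ = ∫ x, r i x * ouGenerator (ψ i) x ∂gibbs (U i) := by
        rw [e2, mul_add, mul_neg, ← neg_mul, neg_neg, ← integral_const_mul, ← integral_const_mul,
          ← integral_add (i3.const_mul _) (i2.const_mul _)]
        congr 1; ext x; rw [ouGenerator]; ring

/-- By duality, apply `A` to the monomials: `1 ↦ 0`, `x ↦ -x/2`, `x² ↦ 1 - x²`. The moments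
therefore vanish by induction on `j`; the base case is that mean zero and second moment one are the
stationary values. -/
lemma integral_adjIterate_mul_pow (hν : UniformMoments fun i => gibbs (U i)) {i : ι}
    (h₁ : ∫ x, x ∂gibbs (U i) = 0) (h₂ : ∫ x, x ^ 2 ∂gibbs (U i) = 1)
    [IsProbabilityMeasure (gibbs (U i))] (j : ℕ) (hU : SmoothPolyGrowth (2 * (j + 1)) U) :
    ∀ p ≤ 2, ∫ x, adjIterate (U i) (j + 1) x * x ^ p ∂gibbs (U i) = 0 := by
  have hU2 : SmoothPolyGrowth 2 U := hU.of_le (by omega)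
  have hr : SmoothPolyGrowth 2 (fun i => adjIterate (U i) j) :=
    SmoothPolyGrowth.adjIterate (hU.of_le (by omega))
  have key : ∀ p : ℕ, SmoothPolyGrowth 2 (fun (_ : ι) x => x ^ p) →
      ∫ x, adjIterate (U i) (j + 1) x * x ^ p ∂gibbs (U i)
        = ∫ x, adjIterate (U i) j x * ouGenerator (fun x => x ^ p) x ∂gibbs (U i) := fun p hp =>
    integral_adjGenerator_mul hν hU2 hr hp i
  have g0 : SmoothPolyGrowth 2 (fun (_ : ι) (x : ℝ) => x ^ 0) := by
    simpa using SmoothPolyGrowth.const 1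
  have g1 : SmoothPolyGrowth 2 (fun (_ : ι) (x : ℝ) => x ^ 1) := by
    simpa using SmoothPolyGrowth.id
  have g2 : SmoothPolyGrowth 2 (fun (_ : ι) (x : ℝ) => x ^ 2) := by
    simpa [pow_two] using (SmoothPolyGrowth.id (ι := ι) (k := 2)).mul SmoothPolyGrowth.id
  have a0 : ouGenerator (fun x => x ^ 0) = fun _ => 0 := by
    ext x; simp [ouGenerator]
  have a1 : ouGenerator (fun x => x ^ 1) = fun x => -(1 / 2) * x := by
    ext x
    simp [ouGenerator]
    ring
  have a2 : ouGenerator (fun x => x ^ 2) = fun x => 1 - x ^ 2 := by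
    ext x
    have h1 : deriv (fun x : ℝ => x ^ 2) = fun x => 2 * x := by ext x; simp
    have h2 : deriv (fun x : ℝ => 2 * x) x = 2 := by simp
    simp only [ouGenerator, h1, h2]
    ring
  have hint : ∀ p : ℕ, SmoothPolyGrowth 2 (fun (_ : ι) x => x ^ p) →
      Integrable (fun x => adjIterate (U i) j x * x ^ p) (gibbs (U i)) := fun p hp =>
    hν.integrable (hr.mul hp).polyGrowth (fun i => ((hr.mul hp).continuous i).measurable) i
  have main : ∫ x, adjIterate (U i) j x * x ^ 1 ∂gibbs (U i) = 0 ∧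
      ∫ x, adjIterate (U i) j x * x ^ 0 ∂gibbs (U i)
        = ∫ x, adjIterate (U i) j x * x ^ 2 ∂gibbs (U i) := by
    cases j with
    | zero => simp [adjIterate, h₁, h₂]
    | succ j =>
      have := integral_adjIterate_mul_pow hν h₁ h₂ j (hU.of_le (by omega))
      rw [this 1 (by norm_num), this 0 (by norm_num), this 2 (by norm_num)]
      simp
  intro p hp
  interval_cases p
  · rw [key 0 g0, a0]; simp
  · rw [key 1 g1, a1]
    have : ∀ x, adjIterate (U i) j x * (-(1 / 2) * x)
        = -(1 / 2) * (adjIterate (U i) j x * x ^ 1) := fun x => by ring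
    simp_rw [this]
    rw [integral_const_mul, main.1, mul_zero]
  · rw [key 2 g2, a2]
    have : ∀ x, adjIterate (U i) j x * (1 - x ^ 2)
        = adjIterate (U i) j x * x ^ 0 - adjIterate (U i) j x * x ^ 2 := fun x => by ring
    simp_rw [this]
    rw [integral_sub (hint 0 g0) (hint 2 g2), main.2, sub_self]

end Families

/-! ### Regularity of the semigroup and Taylor expansion in time -/

section Semigroup

lemma abs_ouSemigroup_le {f : ℝ → ℝ} {M : ℝ} (hM : ∀ x, |f x| ≤ M) (t x : ℝ) :
    |ouSemigroup γ t f x| ≤ M := by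
  have := norm_integral_le_of_norm_le_const (μ := γ) (C := M)
    (f := fun y => f (Real.exp (-t / 2) • x + √(1 - Real.exp (-t)) • y))
    (Eventually.of_forall fun y => hM _)
  simpa [ouSemigroup] using this

lemma continuous_ouSemigroup {f : ℝ → ℝ} (hf : Continuous f) {M : ℝ} (hM : ∀ x, |f x| ≤ M) :
    Continuous (fun p : ℝ × ℝ => ouSemigroup γ p.1 f p.2) :=
  continuous_of_dominated (bound := fun _ => M) (fun p => Continuous.aestronglyMeasurable (by fun_prop))
    (fun p => Eventually.of_forall fun y => hM _) (integrable_const M)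
    (Eventually.of_forall fun y => by fun_prop)

lemma ouSemigroup_zero (f : ℝ → ℝ) (x : ℝ) : ouSemigroup γ 0 f x = f x := by
  simp [ouSemigroup]

lemma hasDerivAt_ouSemigroup_space {f : ℝ → ℝ} (hf : ContDiff ℝ 1 f) {M : ℝ}
    (hM : ∀ x, |f x| ≤ M) (hM' : ∀ x, |deriv f x| ≤ M) (t x : ℝ) :
    HasDerivAt (ouSemigroup γ t f) (Real.exp (-t / 2) * ouSemigroup γ t (deriv f) x) x := by
  have := hasDerivAt_gauss hf hM hM' (p := fun z => Real.exp (-t / 2) * z)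
    (q := fun _ => √(1 - Real.exp (-t))) (p' := fun _ => Real.exp (-t / 2))
    (q' := fun _ => 0) (s := x) (S := Set.univ) Filter.univ_mem (B := |Real.exp (-t / 2)|)
    (fun r _ => by simpa using (hasDerivAt_id r).const_mul (Real.exp (-t / 2)))
    (fun r _ => hasDerivAt_const r _) (fun _ _ => le_rfl)
    (fun _ _ => by simpa using Real.exp_nonneg _)
  refine this.congr_deriv ?_
  simp only [ouSemigroup, smul_eq_mul]
  rw [← integral_const_mul]
  congr 1
  ext y
  ring

variable {φ : ℝ → ℝ} {M : ℝ}

lemma deriv_contDiff_one {φ : ℝ → ℝ} (hφ : ContDiff ℝ 2 φ) : ContDiff ℝ 1 (deriv φ) := by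
  have : ContDiff ℝ (1 + 1) φ := by simpa [one_add_one_eq_two] using hφ
  exact (contDiff_succ_iff_deriv.1 this).2.2

lemma smoothPolyGrowth_ouSemigroup {ι : Type*} (hφ : ContDiff ℝ 2 φ) (hM : ∀ x, |φ x| ≤ M)
    (hM' : ∀ x, |deriv φ x| ≤ M) (hM'' : ∀ x, |deriv (deriv φ) x| ≤ M) (t : ℝ) :
    SmoothPolyGrowth 2 (fun (_ : ι) => ouSemigroup γ t φ) := by
  have hφ1 := deriv_contDiff_one hφ
  have d1 := hasDerivAt_ouSemigroup_space (hφ.of_le (by norm_num)) hM hM' t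
  have d2 := hasDerivAt_ouSemigroup_space hφ1 hM' hM'' t
  have c2 : Continuous (ouSemigroup γ t (deriv (deriv φ))) :=
    (continuous_ouSemigroup (hφ1.continuous_deriv le_rfl) hM'').comp (Continuous.prodMk_right t)
  have e1 : deriv (ouSemigroup γ t φ) = fun x => Real.exp (-t / 2) * ouSemigroup γ t (deriv φ) x :=
    funext fun x => (d1 x).deriv
  have hc : PolyGrowth (fun (_ : ι) (_ : ℝ) => Real.exp (-t / 2)) := .of_bounded fun _ _ => le_rfl
  refine ⟨fun _ x => (d1 x).differentiableAt, .of_bounded fun _ => abs_ouSemigroup_le hM t, ?_⟩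
  simp only [e1]
  have d2' : ∀ x, HasDerivAt (fun x => Real.exp (-t / 2) * ouSemigroup γ t (deriv φ) x)
      (Real.exp (-t / 2) * (Real.exp (-t / 2) * ouSemigroup γ t (deriv (deriv φ)) x)) x :=
    fun x => (d2 x).const_mul _
  refine ⟨fun _ x => (d2' x).differentiableAt,
    hc.mul (.of_bounded fun _ => abs_ouSemigroup_le hM' t), ?_⟩
  simp only [show deriv (fun x => Real.exp (-t / 2) * ouSemigroup γ t (deriv φ) x) = _ from
    funext fun x => (d2' x).deriv]
  exact ⟨fun _ => by fun_prop, hc.mul (hc.mul (.of_bounded fun _ => abs_ouSemigroup_le hM'' t))⟩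

/-- The bound does not depend on `t`, so it serves as the dominating function when differentiating
in time under the integral. -/
lemma abs_ouGenerator_ouSemigroup_le (hφ : ContDiff ℝ 2 φ) (hM : ∀ x, |φ x| ≤ M)
    (hM' : ∀ x, |deriv φ x| ≤ M) (hM'' : ∀ x, |deriv (deriv φ) x| ≤ M) {t : ℝ} (ht : 0 ≤ t) (x : ℝ) :
    |ouGenerator (ouSemigroup γ t φ) x| ≤ M * (1 + x ^ 2) := by
  have hφ1 := deriv_contDiff_one hφ
  have hM0 : 0 ≤ M := (abs_nonneg _).trans (hM 0)
  have d1 := hasDerivAt_ouSemigroup_space (hφ.of_le (by norm_num)) hM hM' t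
  have d2 := hasDerivAt_ouSemigroup_space hφ1 hM' hM'' t
  have e1 : deriv (ouSemigroup γ t φ) = fun x => Real.exp (-t / 2) * ouSemigroup γ t (deriv φ) x :=
    funext fun x => (d1 x).deriv
  have ha : Real.exp (-t / 2) ≤ 1 := Real.exp_le_one_iff.2 (by linarith)
  have ha0 := Real.exp_nonneg (-t / 2)
  have b1 : |deriv (ouSemigroup γ t φ) x| ≤ M := by
    rw [e1, abs_mul, abs_of_nonneg ha0]
    exact (mul_le_of_le_one_left (abs_nonneg _) ha).trans (abs_ouSemigroup_le hM' t x)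
  have b2 : |deriv (deriv (ouSemigroup γ t φ)) x| ≤ M := by
    rw [e1, ((d2 x).const_mul (Real.exp (-t / 2))).deriv, abs_mul, abs_mul, abs_of_nonneg ha0]
    exact (mul_le_of_le_one_left (by positivity) ha).trans
      ((mul_le_of_le_one_left (abs_nonneg _) ha).trans (abs_ouSemigroup_le hM'' t x))
  rw [ouGenerator]
  calc |1 / 2 * deriv (deriv (ouSemigroup γ t φ)) x - x / 2 * deriv (ouSemigroup γ t φ) x|
      ≤ |1 / 2 * deriv (deriv (ouSemigroup γ t φ)) x| + |x / 2 * deriv (ouSemigroup γ t φ) x| :=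
        abs_sub _ _
    _ ≤ 1 / 2 * M + |x| / 2 * M := by
        rw [abs_mul, abs_mul, abs_of_pos (by norm_num : (0 : ℝ) < 1 / 2), abs_div, abs_two]
        gcongr
    _ ≤ M * (1 + x ^ 2) := by
        have : |x| ≤ 1 + x ^ 2 := by rw [← sq_abs x]; nlinarith [sq_nonneg (|x| - 1)]
        nlinarith [mul_le_mul_of_nonneg_left this hM0, sq_nonneg x, mul_nonneg hM0 (sq_nonneg x)]

/-- Taylor's formula for a chain of derivatives, expanded around the right endpoint. -/
lemma abs_taylor_sub_le {G : ℕ → ℝ → ℝ} {n : ℕ} {t M : ℝ} (ht : 0 < t)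
    (hc : ∀ j ≤ n, Continuous (G j))
    (hd : ∀ j ≤ n, ∀ s, 0 < s → HasDerivAt (G j) (G (j + 1) s) s)
    (hM : ∀ s, 0 < s → |G (n + 1) s| ≤ M) :
    |∑ j ∈ Finset.range (n + 1), (-t) ^ j / j.factorial * G j t - G 0 0| ≤ M * t ^ (n + 1) := by
  -- The derivative of the Taylor sum telescopes to its last term.
  have hder : ∀ m ≤ n, ∀ s, 0 < s → HasDerivAt
      (fun s => ∑ j ∈ Finset.range (m + 1), (-s) ^ j / j.factorial * G j s)
      ((-s) ^ m / m.factorial * G (m + 1) s) s := by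
    intro m
    induction m with
    | zero => intro hm s hs; simpa using hd 0 (by omega) s hs
    | succ m ih =>
      intro hm s hs
      simp_rw [Finset.sum_range_succ _ (m + 1)]
      have h1 : HasDerivAt (fun s : ℝ => (-s) ^ (m + 1) / (m + 1).factorial)
          (-((-s) ^ m / m.factorial)) s := by
        refine (((hasDerivAt_id s).neg.pow (m + 1)).div_const _).congr_deriv ?_
        rw [Nat.factorial_succ]
        have : (m.factorial : ℝ) ≠ 0 := by positivity
        push_cast
        simp
        field_simp
      refine ((ih (by omega) s hs).add (h1.mul (hd (m + 1) hm s hs))).congr_deriv ?_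
      ring
  set F := fun s => ∑ j ∈ Finset.range (n + 1), (-s) ^ j / j.factorial * G j s with hF
  have hFc : Continuous F := continuous_finsetSum _ fun j hj => by
    have := hc j (by simpa [Nat.lt_succ_iff] using hj)
    fun_prop
  have hF0 : F 0 = G 0 0 := by
    rw [hF]
    simp only [Finset.sum_range_succ']
    simp
  -- The mean value theorem needs differentiability only on the open interval. This matters because
  -- `√(1 - e^{-s})` in Mehler's formula is not differentiable at `0`.
  obtain ⟨c, ⟨hc0, hct⟩, hc⟩ := exists_hasDerivAt_eq_slope F _ ht hFc.continuousOn
    (fun s hs => hder n le_rfl s hs.1)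
  have h2 : F t - G 0 0 = t * ((-c) ^ n / n.factorial * G (n + 1) c) := by
    rw [hc, hF0, sub_zero]
    field_simp
  change |F t - G 0 0| ≤ _
  have hM0 : 0 ≤ M := (abs_nonneg _).trans (hM c hc0)
  have hfac : (1 : ℝ) ≤ n.factorial := by exact_mod_cast n.factorial_pos
  rw [h2, abs_mul, abs_mul, abs_div, abs_pow, abs_neg, abs_of_pos ht, abs_of_pos hc0, Nat.abs_cast]
  calc t * (c ^ n / n.factorial * |G (n + 1) c|) ≤ t * (t ^ n / 1 * M) := by
        gcongr
        exact hM c hc0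
    _ = M * t ^ (n + 1) := by ring

end Semigroup

/-- The Taylor polynomial of the backward flow, tested against the semigroup. -/
lemma abs_integral_backward_taylor_le {ι : Type*} {U : ι → ℝ → ℝ} {n : ℕ}
    (hν : UniformMoments fun i => gibbs (U i)) (hU : SmoothPolyGrowth (2 * (n + 1)) U)
    {φ : ℝ → ℝ} (hφ : ContDiff ℝ 2 φ) (hφc : HasCompactSupport φ) (hφ1 : ∀ x, |φ x| ≤ 1)
    {t : ℝ} (ht : 0 < t) (i : ι) :
    |∑ j ∈ Finset.range (n + 1), (-t) ^ j / j.factorial *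
        ∫ x, adjIterate (U i) j x * ouSemigroup γ t φ x ∂gibbs (U i) - ∫ x, φ x ∂gibbs (U i)|
      ≤ (∫ x, |adjIterate (U i) (n + 1) x| ∂gibbs (U i)) * t ^ (n + 1) := by
  have hφ' := deriv_contDiff_one hφ
  obtain ⟨M₁, hM₁⟩ := hφc.deriv.exists_bound_of_continuous hφ'.continuous
  obtain ⟨M₂, hM₂⟩ := hφc.deriv.deriv.exists_bound_of_continuous
    (hφ'.continuous_deriv le_rfl)
  obtain ⟨M, hM, hM', hM''⟩ : ∃ M, (∀ x, |φ x| ≤ M) ∧ (∀ x, |deriv φ x| ≤ M) ∧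
      ∀ x, |deriv (deriv φ) x| ≤ M :=
    ⟨1 + |M₁| + |M₂|, fun x => (hφ1 x).trans (by linarith [abs_nonneg M₁, abs_nonneg M₂]),
      fun x => (hM₁ x).trans (by linarith [le_abs_self M₁, abs_nonneg M₂]),
      fun x => (hM₂ x).trans (by linarith [abs_nonneg M₁, le_abs_self M₂])⟩
  have hr : ∀ j ≤ n + 1, SmoothPolyGrowth 0 (fun i => adjIterate (U i) j) := fun j hj =>
    SmoothPolyGrowth.adjIterate (hU.of_le (by omega))
  have hrc : ∀ j ≤ n + 1, Continuous (adjIterate (U i) j) := fun j hj => (hr j hj).continuous i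
  have hri : ∀ j ≤ n + 1, Integrable (adjIterate (U i) j) (gibbs (U i)) := fun j hj =>
    hν.integrable (hr j hj).polyGrowth (fun i => ((hr j hj).continuous i).measurable) i
  have hPc := continuous_ouSemigroup hφ.continuous hφ1
  have hPcs : ∀ s, Continuous (ouSemigroup γ s φ) := fun s =>
    hPc.comp (Continuous.prodMk_right s)
  have hbd : ∀ j s x, ‖adjIterate (U i) j x * ouSemigroup γ s φ x‖ ≤ |adjIterate (U i) j x| :=
    fun j s x => by
      rw [norm_mul]
      exact mul_le_of_le_one_right (abs_nonneg _) (abs_ouSemigroup_le hφ1 s x)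
  have key := abs_taylor_sub_le
    (G := fun j s => ∫ x, adjIterate (U i) j x * ouSemigroup γ s φ x ∂gibbs (U i)) (n := n)
    (M := ∫ x, |adjIterate (U i) (n + 1) x| ∂gibbs (U i)) ht ?_ ?_ ?_
  · simpa [ouSemigroup_zero, adjIterate] using key
  · intro j hj
    have := hrc j (by omega)
    refine continuous_of_dominated (bound := fun x => |adjIterate (U i) j x|)
      (fun s => (this.mul (hPcs s)).aestronglyMeasurable) (fun s => Eventually.of_forall (hbd j s))
      (hri j (by omega)).abs (Eventually.of_forall fun x => ?_)
    exact continuous_const.mul (hPc.comp (Continuous.prodMk_left x))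
  · intro j hj s hs
    have hg : SmoothPolyGrowth 2 (fun (_ : ι) => ouSemigroup γ s φ) :=
      smoothPolyGrowth_ouSemigroup hφ hM hM' hM'' s
    have hr2 : SmoothPolyGrowth 2 (fun i => adjIterate (U i) j) :=
      SmoothPolyGrowth.adjIterate (hU.of_le (by omega))
    -- Duality rewrites the claimed derivative `G_{j+1}(s)` as `∫ r_j A e^{sA}φ dν`, which is what
    -- differentiation under the integral produces.
    have e := integral_adjGenerator_mul hν (hU.of_le (by omega)) hr2 hg i
    change HasDerivAt _ (∫ x, adjGenerator (U i) (adjIterate (U i) j) x * ouSemigroup γ s φ x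
      ∂gibbs (U i)) s
    rw [e]
    have hw : SmoothPolyGrowth 0 (fun i x => adjIterate (U i) j x * (M * (1 + x * x))) :=
      (hr j (by omega)).mul ((SmoothPolyGrowth.const M).mul
        ((SmoothPolyGrowth.const 1).add (SmoothPolyGrowth.id.mul SmoothPolyGrowth.id)))
    have hwi := (hν.integrable hw.polyGrowth (fun i => (hw.continuous i).measurable) i).abs
    have hgc : Continuous (ouGenerator (ouSemigroup γ s φ)) := by
      have c1 := hg.deriv.continuous i
      have c2 := hg.deriv.deriv.continuous i
      unfold ouGenerator
      fun_prop
    have := hrc j (by omega)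
    refine (hasDerivAt_integral_of_dominated_loc_of_deriv_le (s := Ioi 0)
      (F := fun s x => adjIterate (U i) j x * ouSemigroup γ s φ x)
      (F' := fun s x => adjIterate (U i) j x * ouGenerator (ouSemigroup γ s φ) x)
      (bound := fun x => |adjIterate (U i) j x * (M * (1 + x * x))|) (Ioi_mem_nhds hs)
      (Eventually.of_forall fun s => (this.mul (hPcs s)).aestronglyMeasurable) ?_ ?_ ?_ hwi ?_).2
    · exact (hri j (by omega)).mono (this.mul (hPcs s)).aestronglyMeasurable
        (Eventually.of_forall (hbd j s))
    · exact (this.mul hgc).aestronglyMeasurable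
    · refine Eventually.of_forall fun x s hs => ?_
      rw [norm_mul, abs_mul, Real.norm_eq_abs, ← pow_two]
      gcongr
      exact (abs_ouGenerator_ouSemigroup_le hφ hM hM' hM'' (le_of_lt hs) x).trans (le_abs_self _)
    · exact Eventually.of_forall fun x s hs =>
        (hasDerivAt_ouSemigroup hφ hM hM' hM'' hs x).const_mul _
  · intro s _
    exact norm_integral_le_of_norm_le (hri (n + 1) le_rfl).abs
      (Eventually.of_forall (hbd (n + 1) s))

/-! ### Truncation and moment correction -/

/-- Functions with prescribed moments of order `0, 1, 2` with respect to `e^{-U} dx`. -/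
lemma exists_prescribed_moments {U : ℝ → ℝ} (hU : Measurable U) {L : ℝ}
    (hL : ∀ x ∈ Icc (-1 : ℝ) 1, |U x| ≤ L) {c : ℕ → ℝ} {ε : ℝ} (hc : ∀ p ≤ 2, |c p| ≤ ε) :
    ∃ w : ℝ → ℝ, Measurable w ∧ (∀ x, |w x| ≤ 15 * Real.exp L * ε) ∧
      ∀ p ≤ 2, ∫ x, w x * x ^ p ∂gibbs U = c p := by
  have hε : 0 ≤ ε := (abs_nonneg _).trans (hc 0 (by norm_num))
  -- The three polynomials form the basis dual to the moments of order `0, 1, 2` of Lebesgue measure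
  -- on `[-1, 1]`; the factor `e^U` below cancels the weight.
  let P : ℝ → ℝ := fun x => c 0 * (9 / 8 - 15 / 8 * x ^ 2) + c 1 * (3 / 2 * x)
    + c 2 * (45 / 8 * x ^ 2 - 15 / 8)
  refine ⟨(Icc (-1 : ℝ) 1).indicator fun x => Real.exp (U x) * P x,
    Measurable.indicator (by fun_prop) measurableSet_Icc, fun x => ?_, fun p hp => ?_⟩
  · by_cases hx : x ∈ Icc (-1 : ℝ) 1
    · rw [indicator_of_mem hx, abs_mul, abs_of_pos (Real.exp_pos _)]
      have hx2 : x ^ 2 ≤ 1 := by nlinarith [hx.1, hx.2]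
      have hx0 := sq_nonneg x
      have b0 : |9 / 8 - 15 / 8 * x ^ 2| ≤ 2 := abs_le.2 ⟨by linarith, by linarith⟩
      have b1 : |3 / 2 * x| ≤ 2 := abs_le.2 ⟨by linarith [hx.1], by linarith [hx.2]⟩
      have b2 : |45 / 8 * x ^ 2 - 15 / 8| ≤ 4 := abs_le.2 ⟨by linarith, by linarith⟩
      have hP : |P x| ≤ 15 * ε := by
        calc |P x| ≤ |c 0| * |9 / 8 - 15 / 8 * x ^ 2| + |c 1| * |3 / 2 * x|
              + |c 2| * |45 / 8 * x ^ 2 - 15 / 8| := by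
              simp only [← abs_mul]
              exact abs_add_three _ _ _
          _ ≤ ε * 2 + ε * 2 + ε * 4 := by
              gcongr
              exacts [hc 0 (by norm_num), hc 1 (by norm_num), hc 2 le_rfl]
          _ ≤ 15 * ε := by linarith
      calc Real.exp (U x) * |P x| ≤ Real.exp L * (15 * ε) := by
            gcongr
            exact (le_abs_self _).trans (hL x hx)
        _ = _ := by ring
    · rw [indicator_of_notMem hx, abs_zero]
      positivity
  · rw [integral_gibbs hU]
    have : ∀ x, Real.exp (-U x) * ((Icc (-1 : ℝ) 1).indicator
        (fun x => Real.exp (U x) * P x) x * x ^ p)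
        = (Icc (-1 : ℝ) 1).indicator (fun x => P x * x ^ p) x := fun x => by
      by_cases hx : x ∈ Icc (-1 : ℝ) 1
      · rw [indicator_of_mem hx, indicator_of_mem hx, ← mul_assoc, ← mul_assoc, ← Real.exp_add,
          neg_add_cancel, Real.exp_zero, one_mul]
      · simp [indicator_of_notMem hx]
    simp_rw [this]
    rw [integral_indicator measurableSet_Icc, integral_Icc_eq_integral_Ioc,
      ← intervalIntegral.integral_of_le (by norm_num)]
    have e : ∀ x, P x * x ^ p = (9 / 8 * c 0 - 15 / 8 * c 2) * x ^ p
        + 3 / 2 * c 1 * x ^ (p + 1) + (45 / 8 * c 2 - 15 / 8 * c 0) * x ^ (p + 2) := fun x => by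
      simp only [P]; ring
    have ii : ∀ (a : ℝ) (m : ℕ), IntervalIntegrable (fun x : ℝ => a * x ^ m) volume (-1) 1 :=
      fun a m => (by fun_prop : Continuous fun x : ℝ => a * x ^ m).intervalIntegrable _ _
    simp_rw [e]
    rw [intervalIntegral.integral_add ((ii _ _).add (ii _ _)) (ii _ _),
      intervalIntegral.integral_add (ii _ _) (ii _ _)]
    simp only [intervalIntegral.integral_const_mul, integral_pow]
    interval_cases p <;> norm_num <;> ring

lemma PolyGrowth.finsetSum {ι κ : Type*} {f : κ → ι → ℝ → ℝ} (s : Finset κ)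
    (hf : ∀ j ∈ s, PolyGrowth (f j)) : PolyGrowth (fun i x => ∑ j ∈ s, f j i x) := by
  classical
  induction s using Finset.induction_on with
  | empty => simpa using PolyGrowth.of_bounded (ι := ι) (f := fun _ _ => 0) (M := 0) (by simp)
  | insert a s ha ih =>
    simp only [Finset.sum_insert ha]
    exact (hf a (by simp)).add (ih fun j hj => hf j (by simp [hj]))

/-- The nonconstant part of the Taylor polynomial of degree `n` of the backward flow, relative to
the initial density. -/
noncomputable def backwardTaylor (U : ℝ → ℝ) (n : ℕ) (t x : ℝ) : ℝ :=
  ∑ j ∈ Finset.range n, (-t) ^ (j + 1) / (j + 1).factorial * adjIterate U (j + 1) x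

section Perturbation

variable {ι : Type*} {U : ι → ℝ → ℝ} {n : ℕ}

lemma continuous_backwardTaylor (hU : SmoothPolyGrowth (2 * (n + 1)) U) (t : ℝ) (i : ι) :
    Continuous (backwardTaylor (U i) n t) := by
  refine continuous_finsetSum _ fun j hj => ?_
  have hj' := Finset.mem_range.1 hj
  have h : SmoothPolyGrowth 0 (fun i => adjIterate (U i) (j + 1)) :=
    SmoothPolyGrowth.adjIterate (hU.of_le (by omega))
  exact continuous_const.mul (h.continuous i)

lemma exists_backwardTaylor_bound (hU : SmoothPolyGrowth (2 * (n + 1)) U) :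
    ∃ (B : ℝ) (D : ℕ), 0 ≤ B ∧ ∀ i t, 0 < t → t ≤ 1 → ∀ x,
      |backwardTaylor (U i) n t x| ≤ t * (B * (1 + x ^ 2) ^ D) := by
  have : PolyGrowth (fun i x => ∑ j ∈ Finset.range n, |adjIterate (U i) (j + 1) x|) := by
    refine PolyGrowth.finsetSum (f := fun j i x => |adjIterate (U i) (j + 1) x|) _ fun j hj => ?_
    have hj' := Finset.mem_range.1 hj
    have h : SmoothPolyGrowth 0 (fun i => adjIterate (U i) (j + 1)) :=
      SmoothPolyGrowth.adjIterate (hU.of_le (by omega))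
    exact h.polyGrowth.mono fun i x => by simp
  obtain ⟨B, D, hB, h⟩ := this.exists_nonneg
  refine ⟨B, D, hB, fun i t ht ht1 x => ?_⟩
  refine le_trans ?_ (mul_le_mul_of_nonneg_left ((le_abs_self _).trans (h i x)) ht.le)
  rw [Finset.mul_sum]
  refine (Finset.abs_sum_le_sum_abs _ _).trans (Finset.sum_le_sum fun j _ => ?_)
  rw [abs_mul, abs_div, abs_pow, abs_neg, abs_of_pos ht, Nat.abs_cast]
  gcongr
  have hf : (1 : ℝ) ≤ (j + 1).factorial := by exact_mod_cast (j + 1).factorial_pos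
  calc t ^ (j + 1) / (j + 1).factorial ≤ t ^ (j + 1) := div_le_self (by positivity) hf
    _ ≤ t := by
      rw [pow_succ]
      exact mul_le_of_le_one_left ht.le (pow_le_one₀ ht.le ht1)

lemma integral_backwardTaylor_mul_pow (hν : UniformMoments fun i => gibbs (U i)) {i : ι}
    (h₁ : ∫ x, x ∂gibbs (U i) = 0) (h₂ : ∫ x, x ^ 2 ∂gibbs (U i) = 1)
    [IsProbabilityMeasure (gibbs (U i))] (hU : SmoothPolyGrowth (2 * (n + 1)) U) (t : ℝ)
    {p : ℕ} (hp : p ≤ 2) :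
    ∫ x, backwardTaylor (U i) n t x * x ^ p ∂gibbs (U i) = 0 := by
  simp only [backwardTaylor, Finset.sum_mul, mul_assoc]
  have hxp : SmoothPolyGrowth 0 (fun (_ : ι) (x : ℝ) => x ^ p) := by
    refine ⟨fun _ => by fun_prop, 1, 1, fun _ x => ?_⟩
    rw [abs_pow, pow_one, one_mul]
    interval_cases p <;> nlinarith [sq_nonneg (|x| - 1), sq_abs x]
  rw [integral_finsetSum]
  · refine Finset.sum_eq_zero fun j hj => ?_
    have hj' := Finset.mem_range.1 hj
    rw [integral_const_mul, integral_adjIterate_mul_pow hν h₁ h₂ j (hU.of_le (by omega)) p hp,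
      mul_zero]
  · intro j hj
    have hj' := Finset.mem_range.1 hj
    have h : SmoothPolyGrowth 0 (fun i => adjIterate (U i) (j + 1)) :=
      SmoothPolyGrowth.adjIterate (hU.of_le (by omega))
    have h' := h.mul hxp
    have := hν.integrable h'.polyGrowth (fun i => (h'.continuous i).measurable) i
    exact this.const_mul _

/-- The relative density of the backward Taylor polynomial, truncated and corrected so as to be
small uniformly and to preserve mass, mean and variance. -/
lemma exists_truncation (hν : UniformMoments fun i => gibbs (U i))
    (h₁ : ∀ i, ∫ x, x ∂gibbs (U i) = 0) (h₂ : ∀ i, ∫ x, x ^ 2 ∂gibbs (U i) = 1)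
    (hp : ∀ i, IsProbabilityMeasure (gibbs (U i))) (hU : SmoothPolyGrowth (2 * (n + 1)) U) :
    ∃ C t₀ : ℝ, 0 ≤ C ∧ 0 < t₀ ∧ ∀ i t, 0 < t → t ≤ t₀ → ∃ h : ℝ → ℝ, Measurable h ∧
      (∀ x, |h x| ≤ 1 / 3) ∧ (∀ p ≤ 2, ∫ x, h x * x ^ p ∂gibbs (U i) = 0) ∧
      ∫ x, |h x - backwardTaylor (U i) n t x| ∂gibbs (U i) ≤ C * t ^ (n + 1) := by
  obtain ⟨B, D, hB, hBD⟩ := exists_backwardTaylor_bound hU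
  -- Exponent: `D` from the growth of `P`, `1` from `|x ^ p| ≤ 1 + x²`, and `2D(n+1)` from the
  -- factor `(t (1 + x²)^(2D))^(n+1)`, which is at least one on the tail and supplies `t^(n+1)`.
  obtain ⟨M, hM⟩ := hν (D + 1 + 2 * D * (n + 1))
  obtain ⟨B', D', hB', hL⟩ := hU.polyGrowth.exists_nonneg
  set L := B' * 2 ^ D' with hLdef
  set E := B * |M| with hE
  have hE0 : 0 ≤ E := by positivity
  set B₁ := 15 * Real.exp L with hB₁
  have hB₁0 : 0 < B₁ := by positivity
  -- `√t (B + B₁ E)` will bound the corrected density perturbation, so `√t ≤ 1/(3Z)` makes it at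
  -- most `1/3`; the summand `1` keeps `Z` positive.
  set Z := B + B₁ * E + 1 with hZ
  have hZ0 : 0 < Z := by positivity
  refine ⟨E + B₁ * E, min 1 ((1 / (3 * Z)) ^ 2), by positivity, by positivity,
    fun i t ht ht0 => ?_⟩
  have := hp i
  have ht1 : t ≤ 1 := ht0.trans (min_le_left _ _)
  have hsq : √t ≤ 1 / (3 * Z) := Real.sqrt_le_iff.2 ⟨by positivity, ht0.trans (min_le_right _ _)⟩
  have htsq : t ≤ √t := (Real.le_sqrt' ht).2 (by nlinarith)
  have htn : t ^ (n + 1) ≤ t := by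
    rw [pow_succ]
    exact mul_le_of_le_one_left ht.le (pow_le_one₀ ht.le ht1)
  set P := backwardTaylor (U i) n t with hP
  have hPc : Continuous P := continuous_backwardTaylor hU t i
  -- With the exponent `2D`, twice that in the bound for `P`, one still has `|P| ≤ √t B` on `S`.
  let S : Set ℝ := {x | t * (1 + x ^ 2) ^ (2 * D) ≤ 1}
  have hS : MeasurableSet S := measurableSet_le (by fun_prop) measurable_const
  have hPx : ∀ x, |P x| ≤ t * (B * (1 + x ^ 2) ^ D) := hBD i t ht ht1
  have hPS : ∀ x ∈ S, |P x| ≤ √t * B := fun x hx => by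
    have hx' : t * (1 + x ^ 2) ^ (2 * D) ≤ 1 := hx
    refine abs_le_of_sq_le_sq' ?_ (by positivity) |> fun h => abs_le.2 h
    calc P x ^ 2 = |P x| ^ 2 := (sq_abs _).symm
      _ ≤ (t * (B * (1 + x ^ 2) ^ D)) ^ 2 := by gcongr; exact hPx x
      _ = t * B ^ 2 * (t * (1 + x ^ 2) ^ (2 * D)) := by ring
      _ ≤ t * B ^ 2 * 1 := by gcongr
      _ = (√t * B) ^ 2 := by rw [mul_pow, Real.sq_sqrt ht.le, mul_one]
  have htail : ∀ p ≤ 2, ∀ x, |Sᶜ.indicator P x * x ^ p|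
      ≤ t ^ (n + 1) * (B * (1 + x ^ 2) ^ (D + 1 + 2 * D * (n + 1))) := fun p hp x => by
    by_cases hx : x ∈ S
    · rw [indicator_of_notMem (by simpa using hx), zero_mul, abs_zero]
      positivity
    · have hx' : 1 ≤ t * (1 + x ^ 2) ^ (2 * D) := (not_le.1 hx).le
      have hxp : |x ^ p| ≤ 1 + x ^ 2 := by
        rw [abs_pow]
        interval_cases p <;> nlinarith [sq_nonneg (|x| - 1), sq_abs x]
      rw [indicator_of_mem (by exact hx), abs_mul]
      have hPB : |P x| ≤ B * (1 + x ^ 2) ^ D :=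
        (hPx x).trans (mul_le_of_le_one_left (by positivity) ht1)
      calc |P x| * |x ^ p| ≤ (B * (1 + x ^ 2) ^ D) * (1 + x ^ 2) := by gcongr
        _ ≤ (B * (1 + x ^ 2) ^ D) * (1 + x ^ 2) * (t * (1 + x ^ 2) ^ (2 * D)) ^ (n + 1) :=
            le_mul_of_one_le_right (by positivity) (one_le_pow₀ hx')
        _ = _ := by ring
  have htailI : ∀ p ≤ 2, Integrable (fun x => Sᶜ.indicator P x * x ^ p) (gibbs (U i)) := fun p hp =>
    (((hM i).1.const_mul B).const_mul (t ^ (n + 1))).mono'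
      ((hPc.measurable.indicator hS.compl).mul (by fun_prop)).aestronglyMeasurable
      (Eventually.of_forall (htail p hp))
  have htailE : ∀ p ≤ 2, ∫ x, |Sᶜ.indicator P x * x ^ p| ∂gibbs (U i) ≤ E * t ^ (n + 1) := fun p hp => by
    refine (integral_mono_of_nonneg (Eventually.of_forall fun _ => abs_nonneg _)
      (((hM i).1.const_mul B).const_mul (t ^ (n + 1))) (Eventually.of_forall (htail p hp))).trans ?_
    rw [integral_const_mul, integral_const_mul, mul_comm (t ^ (n + 1)), hE]
    gcongr
    exact (hM i).2.trans (le_abs_self M)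
  have hPI : ∀ p ≤ 2, Integrable (fun x => P x * x ^ p) (gibbs (U i)) := fun p hp => by
    obtain ⟨M', hM'⟩ := hν (D + 1)
    refine ((hM' i).1.const_mul B).mono' (by fun_prop) (Eventually.of_forall fun x => ?_)
    have hxp : |x ^ p| ≤ 1 + x ^ 2 := by
      rw [abs_pow]
      interval_cases p <;> nlinarith [sq_nonneg (|x| - 1), sq_abs x]
    rw [norm_mul, Real.norm_eq_abs, Real.norm_eq_abs, pow_succ, ← mul_assoc]
    gcongr
    exact (hPx x).trans (mul_le_of_le_one_left (by positivity) ht1)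
  -- `w` restores the moments removed with the tail of `P`. These are `O(t^(n+1))`, hence so is `w`,
  -- and the correction does not spoil the order of approximation.
  obtain ⟨w, hwm, hwb, hwc⟩ := exists_prescribed_moments (hU.continuous i).measurable (L := L)
    (fun x hx => (hL i x).trans (by
      have : x ^ 2 ≤ 1 := by nlinarith [hx.1, hx.2]
      rw [hLdef]
      gcongr
      linarith))
    (c := fun p => ∫ x, Sᶜ.indicator P x * x ^ p ∂gibbs (U i)) (ε := E * t ^ (n + 1))
    (fun p hp => (abs_integral_le_integral_abs).trans (htailE p hp))
  have hwI : ∀ p ≤ 2, Integrable (fun x => w x * x ^ p) (gibbs (U i)) := fun p hp => by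
    obtain ⟨M', hM'⟩ := hν 1
    refine ((hM' i).1.const_mul (15 * Real.exp L * (E * t ^ (n + 1)))).mono' (by fun_prop)
      (Eventually.of_forall fun x => ?_)
    have hxp : |x ^ p| ≤ 1 + x ^ 2 := by
      rw [abs_pow]
      interval_cases p <;> nlinarith [sq_nonneg (|x| - 1), sq_abs x]
    rw [norm_mul, Real.norm_eq_abs, Real.norm_eq_abs, pow_one]
    gcongr
    exact hwb x
  have hdec : ∀ x, S.indicator P x = P x - Sᶜ.indicator P x := fun x => by
    by_cases hx : x ∈ S <;> simp [hx]
  refine ⟨fun x => S.indicator P x + w x, (hPc.measurable.indicator hS).add hwm, fun x => ?_,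
    fun p hp => ?_, ?_⟩
  · have h1 : |S.indicator P x| ≤ √t * B := by
      by_cases hx : x ∈ S
      · rw [indicator_of_mem hx]; exact hPS x hx
      · rw [indicator_of_notMem hx, abs_zero]; positivity
    calc |S.indicator P x + w x| ≤ √t * B + B₁ * (E * t ^ (n + 1)) :=
          (abs_add_le _ _).trans (add_le_add h1 (hwb x))
      _ ≤ √t * B + B₁ * (E * √t) := by
          gcongr
          exact htn.trans htsq
      _ = √t * (B + B₁ * E) := by ring
      _ ≤ 1 / (3 * Z) * Z := by gcongr; linarith
      _ = 1 / 3 := by field_simp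
  · have e : ∀ x, (S.indicator P x + w x) * x ^ p
        = P x * x ^ p - Sᶜ.indicator P x * x ^ p + w x * x ^ p := fun x => by
      rw [hdec]; ring
    simp_rw [e]
    have hi : Integrable (fun x => P x * x ^ p - Sᶜ.indicator P x * x ^ p) (gibbs (U i)) :=
      (hPI p hp).sub (htailI p hp)
    rw [integral_add hi (hwI p hp), integral_sub (hPI p hp) (htailI p hp), hwc p hp,
      integral_backwardTaylor_mul_pow hν (h₁ i) (h₂ i) hU t hp]
    ring
  · have h0 := htailI 0 (by norm_num)
    have h0' := htailE 0 (by norm_num)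
    simp only [pow_zero, mul_one] at h0 h0'
    calc ∫ x, |S.indicator P x + w x - P x| ∂gibbs (U i)
        ≤ ∫ x, (|Sᶜ.indicator P x| + B₁ * (E * t ^ (n + 1))) ∂gibbs (U i) := by
          refine integral_mono_of_nonneg (Eventually.of_forall fun _ => abs_nonneg _)
            (h0.abs.add (integrable_const _)) (Eventually.of_forall fun x => ?_)
          have : S.indicator P x + w x - P x = -Sᶜ.indicator P x + w x := by rw [hdec]; ring
          simp only [this]
          refine (abs_add_le _ _).trans ?_
          rw [abs_neg]
          exact add_le_add_right (hwb x) _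
      _ ≤ E * t ^ (n + 1) + B₁ * (E * t ^ (n + 1)) := by
          rw [integral_add h0.abs (integrable_const _)]
          simpa using h0'
      _ = (E + B₁ * E) * t ^ (n + 1) := by ring

end Perturbation

/-! ### Densities relative to the Gaussian measure -/

lemma integral_withGauss {g : ℝ → ℝ} (hg : Measurable g) (h0 : ∀ x, 0 ≤ g x) (f : ℝ → ℝ) :
    ∫ x, f x ∂withGauss g = ∫ x, g x * f x ∂γ := by
  rw [withGauss, integral_withDensity_eq_integral_toReal_smul (by fun_prop) (by simp)]
  simp [ENNReal.toReal_ofReal, h0]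

lemma IsProbDensity.isProbabilityMeasure {g : ℝ → ℝ} (hg : IsProbDensity g) :
    IsProbabilityMeasure (withGauss g) :=
  ⟨by rw [withGauss, withDensity_apply _ MeasurableSet.univ, setLIntegral_univ,
    hg.lintegral_eq_one]⟩

lemma isStandardized_iff {ν : Measure ℝ} :
    IsStandardized ν ↔ ∫ x, x ∂ν = 0 ∧ ∫ x, x ^ 2 ∂ν = 1 := by
  refine and_congr_right fun h => ?_
  rw [variance_of_integral_eq_zero (by fun_prop) h]

/-- The density, with respect to the Gaussian measure, of `(1 + h) e^{-U} dx`. -/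
noncomputable def gaussDensity (U h : ℝ → ℝ) (x : ℝ) : ℝ :=
  Real.exp (-U x) / gaussianPDFReal 0 1 x * (1 + h x)

section Density

variable {U h : ℝ → ℝ}

lemma measurable_gaussDensity (hU : Measurable U) (hh : Measurable h) :
    Measurable (gaussDensity U h) := by
  have := measurable_gaussianPDFReal 0 1
  unfold gaussDensity
  fun_prop

lemma gaussDensity_nonneg (h0 : ∀ x, 0 ≤ 1 + h x) (x : ℝ) : 0 ≤ gaussDensity U h x :=
  mul_nonneg (div_nonneg (Real.exp_nonneg _) (gaussianPDFReal_nonneg _ _ _)) (h0 x)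

lemma withGauss_gaussDensity (hU : Measurable U) (hh : Measurable h) :
    withGauss (gaussDensity U h) = (gibbs U).withDensity (fun x => ENNReal.ofReal (1 + h x)) := by
  have hm := measurable_gaussDensity hU hh
  rw [withGauss, γ, gaussianReal_of_var_ne_zero _ one_ne_zero, gibbs,
    ← withDensity_mul _ (measurable_gaussianPDF _ _) (by fun_prop),
    ← withDensity_mul _ (by fun_prop) (by fun_prop)]
  congr 1
  ext x
  have hp := gaussianPDFReal_pos 0 1 x one_ne_zero
  simp only [Pi.mul_apply, gaussianPDF]
  rw [← ENNReal.ofReal_mul hp.le, ← ENNReal.ofReal_mul (Real.exp_nonneg _), gaussDensity]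
  congr 1
  field_simp

lemma integral_withGauss_gaussDensity (hU : Measurable U) (hh : Measurable h)
    (h0 : ∀ x, 0 ≤ 1 + h x) (f : ℝ → ℝ) :
    ∫ x, f x ∂withGauss (gaussDensity U h) = ∫ x, (1 + h x) * f x ∂gibbs U := by
  rw [withGauss_gaussDensity hU hh,
    integral_withDensity_eq_integral_toReal_smul (by fun_prop) (by simp)]
  simp [ENNReal.toReal_ofReal, h0]

lemma isProbDensity_gaussDensity (hU : Measurable U) (hh : Measurable h)
    [IsProbabilityMeasure (gibbs U)] (hb : ∀ x, |h x| ≤ 1 / 3) (hI : ∫ x, h x ∂gibbs U = 0) :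
    IsProbDensity (gaussDensity U h) := by
  have h0 : ∀ x, 0 ≤ 1 + h x := fun x => by linarith [(abs_le.1 (hb x)).1]
  have hi : Integrable h (gibbs U) :=
    Integrable.of_bound hh.aestronglyMeasurable (1 / 3) (Eventually.of_forall hb)
  refine ⟨measurable_gaussDensity hU hh, gaussDensity_nonneg h0, ?_⟩
  have e : ∫⁻ x, ENNReal.ofReal (gaussDensity U h x) ∂γ = withGauss (gaussDensity U h) univ := by
    rw [withGauss, withDensity_apply _ MeasurableSet.univ, setLIntegral_univ]
  have hi' : Integrable (fun x => 1 + h x) (gibbs U) := (integrable_const 1).add hi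
  rw [e, withGauss_gaussDensity hU hh, withDensity_apply _ MeasurableSet.univ, setLIntegral_univ,
    ← ofReal_integral_eq_lintegral_ofReal hi' (Eventually.of_forall h0),
    integral_add (integrable_const 1) hi, hI]
  simp

lemma smul_gibbs_le (hU : Measurable U) (hh : Measurable h) (hb : ∀ x, |h x| ≤ 1 / 3) :
    (2 / 3 : ℝ≥0) • gibbs U ≤ withGauss (gaussDensity U h) := by
  rw [withGauss_gaussDensity hU hh]
  change ((2 / 3 : ℝ≥0) : ℝ≥0∞) • gibbs U ≤ _
  rw [← withDensity_const]
  refine withDensity_mono (Eventually.of_forall fun x => ?_)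
  rw [← ENNReal.ofReal_coe_nnreal]
  refine ENNReal.ofReal_le_ofReal ?_
  push_cast
  linarith [(abs_le.1 (hb x)).1]

lemma le_smul_gibbs (hU : Measurable U) (hh : Measurable h) (hb : ∀ x, |h x| ≤ 1 / 3) :
    withGauss (gaussDensity U h) ≤ (4 / 3 : ℝ≥0) • gibbs U := by
  rw [withGauss_gaussDensity hU hh]
  change _ ≤ ((4 / 3 : ℝ≥0) : ℝ≥0∞) • gibbs U
  rw [← withDensity_const]
  refine withDensity_mono (Eventually.of_forall fun x => ?_)
  rw [← ENNReal.ofReal_coe_nnreal]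
  refine ENNReal.ofReal_le_ofReal ?_
  push_cast
  linarith [(abs_le.1 (hb x)).2]

end Density

/-! ### Approximate inversion of the flow -/

/-- Symmetry moves the semigroup from the density `g` onto the test function, so that no regularity
of the truncated `g` is needed. -/
lemma integral_abs_ouSemigroup_sub_le {u g : ℝ → ℝ} (hu : IsProbDensity u) (hg : IsProbDensity g)
    {t : ℝ} (ht : 0 ≤ t) {M : ℝ}
    (h : ∀ φ : ℝ → ℝ, ContDiff ℝ 2 φ → HasCompactSupport φ → (∀ x, |φ x| ≤ 1) →
      ∫ x, ouSemigroup γ t φ x ∂withGauss g - ∫ x, φ x ∂withGauss u ≤ M) :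
    ∫ x, |ouSemigroup γ t g x - u x| ∂γ ≤ M := by
  have hP := integrable_ouSemigroup hg.integrable ht
  refine integral_abs_le_of_forall_contDiff
    ((measurable_ouSemigroup hg.measurable t).sub hu.measurable) (hP.sub hu.integrable)
    fun φ h1 h2 h3 => ?_
  have hφm := h1.continuous.measurable
  have i1 : Integrable (fun x => ouSemigroup γ t g x * φ x) γ :=
    hP.mul_bdd (c := 1) hφm.aestronglyMeasurable (Eventually.of_forall h3)
  have i2 : Integrable (fun x => u x * φ x) γ :=
    hu.integrable.mul_bdd (c := 1) hφm.aestronglyMeasurable (Eventually.of_forall h3)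
  have := h φ h1 h2 h3
  rw [integral_withGauss hg.measurable hg.nonneg, integral_withGauss hu.measurable hu.nonneg,
    ← integral_ouSemigroup_mul hg.integrable hφm h3 ht] at this
  calc ∫ x, (ouSemigroup γ t g x - u x) * φ x ∂γ
      = ∫ x, (ouSemigroup γ t g x * φ x - u x * φ x) ∂γ := by simp only [sub_mul]
    _ ≤ M := by rwa [integral_sub i1 i2]

lemma integral_abs_ouSemigroup_sub_le_two {u : ℝ → ℝ} (hu : IsProbDensity u) {t : ℝ} (ht : 0 ≤ t) :
    ∫ x, |ouSemigroup γ t u x - u x| ∂γ ≤ 2 := by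
  have hP := integrable_ouSemigroup hu.integrable ht
  calc ∫ x, |ouSemigroup γ t u x - u x| ∂γ ≤ ∫ x, (ouSemigroup γ t u x + u x) ∂γ := by
        refine integral_mono (hP.sub hu.integrable).abs (hP.add hu.integrable) fun x => ?_
        have h1 : 0 ≤ ouSemigroup γ t u x := integral_nonneg fun y => hu.nonneg _
        have h2 := hu.nonneg x
        exact abs_le.2 ⟨by linarith, by linarith⟩
    _ = 2 := by
        rw [integral_add hP hu.integrable, integral_ouSemigroup hu.integrable ht,
          hu.integral_eq_one]
        norm_num

/-- The potentials admitted by the decay and regularity conditions. -/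
structure IsAdmissible (m : ℕ) (C₀ q : ℝ) (C₁ C₂ : ℕ → ℝ) (U : ℝ → ℝ) : Prop where
  contDiff : ContDiff ℝ m U
  bound : ∀ j ≤ m, ∀ x : ℝ, |iteratedDeriv j U x| ≤ C₁ j * (1 + x ^ 2) ^ (C₂ j)
  isProbabilityMeasure : IsProbabilityMeasure (gibbs U)
  integral_id : ∫ x, x ∂gibbs U = 0
  integral_sq : ∫ x, x ^ 2 ∂gibbs U = 1
  subexpDecay : SubexpDecay (gibbs U) C₀ q

lemma smoothPolyGrowth_of_isAdmissible (m : ℕ) (C₀ q : ℝ) (C₁ C₂ : ℕ → ℝ) :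
    SmoothPolyGrowth m (fun U : {U // IsAdmissible m C₀ q C₁ C₂ U} => U.1) := by
  refine SmoothPolyGrowth.of_iteratedDeriv (fun U => U.2.contDiff) fun j hj =>
    ⟨|C₁ j|, ⌈C₂ j⌉₊, fun U x => (U.2.bound j hj x).trans ?_⟩
  have : (1 + x ^ 2) ^ (C₂ j) ≤ (1 + x ^ 2) ^ ⌈C₂ j⌉₊ := by
    rw [← Real.rpow_natCast (1 + x ^ 2)]
    exact Real.rpow_le_rpow_of_exponent_le (one_le_one_add_sq x) (Nat.le_ceil _)
  gcongr
  exact le_abs_self _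

lemma uniformMoments_of_isAdmissible (m : ℕ) (C₀ : ℝ) {q : ℝ} (hq : 0 < q) (C₁ C₂ : ℕ → ℝ) :
    UniformMoments (fun U : {U // IsAdmissible m C₀ q C₁ C₂ U} => gibbs U.1) := fun p =>
  let ⟨M, hM⟩ := exists_moment_le C₀ hq p
  ⟨M, fun U => hM _ U.2.isProbabilityMeasure U.2.subexpDecay⟩

/-- The approximate inversion of the Ornstein–Uhlenbeck flow for small times. -/
lemma exists_backward_density (n : ℕ) (C₀ : ℝ) {q : ℝ} (hq : 0 < q) (C₁ C₂ : ℕ → ℝ) :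
    ∃ C t₀ : ℝ, 0 ≤ C ∧ 0 < t₀ ∧ ∀ u : ℝ → ℝ, IsProbDensity u → IsStandardized (withGauss u) →
      SubexpDecay (withGauss u) C₀ q → RegularDensity (withGauss u) (2 * (n + 1)) C₁ C₂ →
      ∀ t : ℝ, 0 < t → t ≤ t₀ → ∃ g : ℝ → ℝ, IsProbDensity g ∧ IsStandardized (withGauss g) ∧
        ∫ x, |ouSemigroup γ t g x - u x| ∂γ ≤ C * t ^ (n + 1) ∧
        (2 / 3 : ℝ≥0) • withGauss u ≤ withGauss g ∧
        withGauss g ≤ (4 / 3 : ℝ≥0) • withGauss u := by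
  have hU := smoothPolyGrowth_of_isAdmissible (2 * (n + 1)) C₀ q C₁ C₂
  have hν := uniformMoments_of_isAdmissible (2 * (n + 1)) C₀ hq C₁ C₂
  obtain ⟨C, t₀, hC, ht₀, H⟩ := exists_truncation hν (fun U => U.2.integral_id)
    (fun U => U.2.integral_sq) (fun U => U.2.isProbabilityMeasure) hU
  have hr : ∀ j ≤ n + 1, SmoothPolyGrowth 0
      (fun U : {U // IsAdmissible (2 * (n + 1)) C₀ q C₁ C₂ U} => adjIterate U.1 j) := fun j hj =>
    SmoothPolyGrowth.adjIterate (hU.of_le (by omega))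
  obtain ⟨M, hM0, hM⟩ := hν.integral_le (hr (n + 1) le_rfl).polyGrowth
  refine ⟨M + C, t₀, by positivity, ht₀, fun u hu hstd hdecay hreg t ht htt => ?_⟩
  obtain ⟨V, hVc, hVu, hVb⟩ := hreg
  change withGauss u = gibbs V at hVu
  have hprob := hu.isProbabilityMeasure
  rw [isStandardized_iff] at hstd
  rw [hVu] at hstd hdecay hprob
  -- The index set of the families consists of all potentials admissible for the given constants;
  -- the bounds obtained above are thus uniform in `u`.
  let W : {U // IsAdmissible (2 * (n + 1)) C₀ q C₁ C₂ U} :=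
    ⟨V, hVc, hVb, hprob, hstd.1, hstd.2, hdecay⟩
  have hVm : Measurable V := hVc.continuous.measurable
  obtain ⟨h, hhm, hhb, hh0, hhC⟩ := H W t ht htt
  change ∀ p ≤ 2, ∫ x, h x * x ^ p ∂gibbs V = 0 at hh0
  change ∫ x, |h x - backwardTaylor V n t x| ∂gibbs V ≤ _ at hhC
  have h0 : ∀ x, 0 ≤ 1 + h x := fun x => by linarith [(abs_le.1 (hhb x)).1]
  have hg : IsProbDensity (gaussDensity V h) :=
    isProbDensity_gaussDensity hVm hhm hhb (by simpa using hh0 0 (by norm_num))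
  have hhi : Integrable h (gibbs V) :=
    Integrable.of_bound hhm.aestronglyMeasurable (1 / 3) (Eventually.of_forall hhb)
  have hpow : ∀ p ≤ 2, Integrable (fun x : ℝ => x ^ p) (gibbs V) := fun p hp => by
    have := hν.integrable (f := fun _ x => x ^ p) ⟨1, 1, fun _ x => by
      rw [abs_pow, pow_one, one_mul]
      interval_cases p <;> nlinarith [sq_nonneg (|x| - 1), sq_abs x]⟩ (fun _ => by fun_prop) W
    exact this
  have hmom : ∀ p ≤ 2, ∫ x, x ^ p ∂withGauss (gaussDensity V h) = ∫ x, x ^ p ∂gibbs V := fun p hp => by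
    rw [integral_withGauss_gaussDensity hVm hhm h0]
    have i2 : Integrable (fun x => h x * x ^ p) (gibbs V) :=
      (hpow p hp).bdd_mul (c := 1 / 3) hhm.aestronglyMeasurable (Eventually.of_forall hhb)
    simp_rw [add_mul, one_mul]
    rw [integral_add (hpow p hp) i2, hh0 p hp, add_zero]
  refine ⟨gaussDensity V h, hg, ?_, ?_, ?_, ?_⟩
  · rw [isStandardized_iff]
    have m1 := hmom 1 (by norm_num)
    simp only [pow_one] at m1
    exact ⟨m1.trans hstd.1, (hmom 2 le_rfl).trans hstd.2⟩
  · refine integral_abs_ouSemigroup_sub_le hu hg ht.le fun φ hφ hφc hφ1 => ?_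
    rw [integral_withGauss_gaussDensity hVm hhm h0, hVu]
    have key := abs_integral_backward_taylor_le hν hU hφ hφc hφ1 ht W
    change |∑ j ∈ Finset.range (n + 1), (-t) ^ j / j.factorial *
      ∫ x, adjIterate V j x * ouSemigroup γ t φ x ∂gibbs V - ∫ x, φ x ∂gibbs V| ≤ _ at key
    have hPc : Continuous (ouSemigroup γ t φ) :=
      (continuous_ouSemigroup hφ.continuous hφ1).comp (Continuous.prodMk_right t)
    have hPb : ∀ x, |ouSemigroup γ t φ x| ≤ 1 := abs_ouSemigroup_le hφ1 t
    have hPi : Integrable (ouSemigroup γ t φ) (gibbs V) :=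
      Integrable.of_bound hPc.aestronglyMeasurable 1 (Eventually.of_forall hPb)
    have hri : ∀ j ≤ n + 1, Integrable (fun x => adjIterate V j x * ouSemigroup γ t φ x) (gibbs V) :=
      fun j hj => by
        have : Integrable (adjIterate V j) (gibbs V) :=
          hν.integrable (hr j hj).polyGrowth (fun i => ((hr j hj).continuous i).measurable) W
        exact this.mul_bdd (c := 1) hPc.aestronglyMeasurable (Eventually.of_forall hPb)
    have hTi : Integrable (fun x => backwardTaylor V n t x * ouSemigroup γ t φ x) (gibbs V) := by
      simp only [backwardTaylor, Finset.sum_mul, mul_assoc]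
      refine integrable_finsetSum _ fun j hj => (hri (j + 1) ?_).const_mul _
      have := Finset.mem_range.1 hj
      omega
    have hT : ∑ j ∈ Finset.range (n + 1), (-t) ^ j / j.factorial *
        ∫ x, adjIterate V j x * ouSemigroup γ t φ x ∂gibbs V
        = ∫ x, ouSemigroup γ t φ x ∂gibbs V
          + ∫ x, backwardTaylor V n t x * ouSemigroup γ t φ x ∂gibbs V := by
      rw [Finset.sum_range_succ', add_comm]
      congr 1
      · simp [adjIterate]
      · simp only [backwardTaylor, Finset.sum_mul, mul_assoc]
        rw [integral_finsetSum]
        · simp_rw [integral_const_mul]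
        · intro j hj
          have := Finset.mem_range.1 hj
          exact (hri (j + 1) (by omega)).const_mul _
    have hhPi : Integrable (fun x => h x * ouSemigroup γ t φ x) (gibbs V) :=
      hhi.mul_bdd (c := 1) hPc.aestronglyMeasurable (Eventually.of_forall hPb)
    -- Replacing `h` by the Taylor polynomial costs its `L¹(ν)` distance, since `|e^{tA}φ| ≤ 1`;
    -- what remains is the Taylor sum controlled by `key`.
    have hsplit : ∫ x, (1 + h x) * ouSemigroup γ t φ x ∂gibbs V
        = (∫ x, ouSemigroup γ t φ x ∂gibbs V
          + ∫ x, backwardTaylor V n t x * ouSemigroup γ t φ x ∂gibbs V)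
          + ∫ x, (h x - backwardTaylor V n t x) * ouSemigroup γ t φ x ∂gibbs V := by
      simp_rw [add_mul, sub_mul, one_mul]
      rw [integral_add hPi hhPi, integral_sub hhPi hTi]
      ring
    have hTi' : Integrable (backwardTaylor V n t) (gibbs V) :=
      integrable_finsetSum _ fun j hj => by
        have hj' := Finset.mem_range.1 hj
        have := hr (j + 1) (by omega)
        have : Integrable (adjIterate V (j + 1)) (gibbs V) :=
          hν.integrable this.polyGrowth (fun i => (this.continuous i).measurable) W
        exact this.const_mul _
    have hdi : Integrable (fun x => h x - backwardTaylor V n t x) (gibbs V) := hhi.sub hTi'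
    have herr : |∫ x, (h x - backwardTaylor V n t x) * ouSemigroup γ t φ x ∂gibbs V|
        ≤ C * t ^ (n + 1) := by
      refine le_trans (norm_integral_le_of_norm_le
        (f := fun x => (h x - backwardTaylor V n t x) * ouSemigroup γ t φ x) hdi.abs
        (Eventually.of_forall fun x => ?_)) hhC
      rw [norm_mul]
      exact mul_le_of_le_one_right (abs_nonneg _) (hPb x)
    rw [hsplit, ← hT]
    have hMW : (∫ x, |adjIterate V (n + 1) x| ∂gibbs V) * t ^ (n + 1) ≤ M * t ^ (n + 1) := by
      gcongr
      exact hM W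
    have k1 := (le_abs_self _).trans (key.trans hMW)
    have k2 := (le_abs_self _).trans herr
    rw [add_mul]
    linarith
  · rw [hVu]; exact smul_gibbs_le hVm hhm hhb
  · rw [hVu]; exact le_smul_gibbs hVm hhm hhb

lemma smul_le_of_le_smul {μ ν : Measure ℝ} {c d e : ℝ≥0} (h : μ ≤ c • ν) (hd : d * c = e) :
    d • μ ≤ e • ν := by
  intro s
  have := h s
  simp only [Measure.smul_apply] at this ⊢
  calc d • μ s ≤ d • c • ν s := by
        simp only [ENNReal.smul_def, smul_eq_mul] at this ⊢
        gcongr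
    _ = e • ν s := by rw [smul_smul, hd]

end ReverseHeatFlow

/-! ### Assembly -/

theorem proposition4p1 (K : ℕ) (hK : 1 ≤ K) :
    -- `α` depends only on `K`
    ∃ α : ℝ, 0 < α ∧
    ∀ (C₀ q : ℝ) (C₁ C₂ : ℕ → ℝ), 0 < q →
    -- `C` depends only on `K` and on the constants in the two conditions on `ν = u dγ`
    ∃ C : ℝ, 0 < C ∧
    ∀ u : ℝ → ℝ, IsProbDensity u → IsStandardized (withGauss u) →
      SubexpDecay (withGauss u) C₀ q → RegularDensity (withGauss u) (2 * K) C₁ C₂ →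
    ∀ t : ℝ, 0 < t → t ≤ α →
    ∃ g : ℝ → ℝ, IsProbDensity g ∧ IsStandardized (withGauss g) ∧
      eLpNorm (fun x => ouSemigroup γ t g x - u x) 1 γ ≤ ENNReal.ofReal (C * t ^ K) ∧
      (∀ θ : ℝ, LSI (withGauss u) θ → LSI (withGauss g) (2 * θ)) ∧
      (∀ θ : ℝ, LSI (withGauss g) θ → LSI (withGauss u) (2 * θ)) ∧
      ∀ N : ℕ,
        eLpNorm (fun x => ouSemigroup (γn (N ^ 2)) t (tensorPow (N ^ 2) g) x
            - tensorPow (N ^ 2) u x) 1 (γn (N ^ 2))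
          ≤ ENNReal.ofReal (C * (N : ℝ) ^ 2 * t ^ K) := by
  obtain ⟨n, rfl⟩ : ∃ n, K = n + 1 := ⟨K - 1, by omega⟩
  -- The threshold `t₀` depends on the decay and regularity constants, so it cannot serve as `α`.
  -- Times beyond `t₀` are absorbed into `C` instead: there `g = u` works, the `L¹` distance being
  -- at most `2 ≤ (2 / t₀^(n+1)) t^(n+1)`.
  refine ⟨1, one_pos, fun C₀ q C₁ C₂ hq => ?_⟩
  obtain ⟨C, t₀, hC, ht₀, H⟩ := exists_backward_density n C₀ hq C₁ C₂
  refine ⟨C + 2 / t₀ ^ (n + 1), by positivity, fun u hu hstd hdecay hreg t ht _ => ?_⟩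
  obtain ⟨g, hg, hgstd, hgL, hl, hr⟩ : ∃ g : ℝ → ℝ, IsProbDensity g ∧ IsStandardized (withGauss g) ∧
      ∫ x, |ouSemigroup γ t g x - u x| ∂γ ≤ (C + 2 / t₀ ^ (n + 1)) * t ^ (n + 1) ∧
        (2 / 3 : NNReal) • withGauss u ≤ withGauss g ∧
        withGauss g ≤ (4 / 3 : NNReal) • withGauss u := by
    rcases le_or_gt t t₀ with htt | htt
    · obtain ⟨g, h1, h2, h3, h4⟩ := H u hu hstd hdecay hreg t ht htt
      refine ⟨g, h1, h2, h3.trans ?_, h4⟩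
      gcongr
      exact le_add_of_nonneg_right (by positivity)
    · have scale : ∀ {c d : NNReal}, c ≤ d → c • withGauss u ≤ d • withGauss u := fun hcd s => by
        simp only [Measure.smul_apply, ENNReal.smul_def, smul_eq_mul]
        gcongr
      refine ⟨u, hu, hstd, (integral_abs_ouSemigroup_sub_le_two hu ht.le).trans ?_, ?_, ?_⟩
      · have h1 : 2 ≤ 2 / t₀ ^ (n + 1) * t ^ (n + 1) := by
          rw [div_mul_eq_mul_div, le_div_iff₀ (by positivity)]
          gcongr
        have h2 : 0 ≤ C * t ^ (n + 1) := by positivity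
        rw [add_mul]
        linarith
      · simpa using scale (c := 2 / 3) (d := 1) (by
          rw [← NNReal.coe_le_coe]; push_cast; norm_num)
      · simpa using scale (c := 1) (d := 4 / 3) (by
          rw [← NNReal.coe_le_coe]; push_cast; norm_num)
  have := hu.isProbabilityMeasure
  have := hg.isProbabilityMeasure
  -- Holley–Stroock is applied in both directions: `2/3` and `4/3 = 2 · 2/3` for `g` against `u`,
  -- and the reciprocals `3/4` and `3/2 = 2 · 3/4` for `u` against `g`.
  refine ⟨g, hg, hgstd, ?_, fun θ h => h.of_comparable (c := 2 / 3) (by simp) hl ?_,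
    fun θ h => h.of_comparable (c := 3 / 4) (by simp) ?_ ?_, fun N => ?_⟩
  · have hi : Integrable (fun x => ouSemigroup γ t g x - u x) γ :=
      (integrable_ouSemigroup hg.integrable ht.le).sub hu.integrable
    rw [eLpNorm_one_eq_ofReal_integral_abs hi]
    exact ENNReal.ofReal_le_ofReal hgL
  · convert hr using 2
    ring
  · have := smul_le_of_le_smul (d := 3 / 4) (e := 1) hr (by ext; push_cast; norm_num)
    simpa using this
  · have h1 : withGauss u ≤ (3 / 2 : NNReal) • withGauss g := by
      intro s
      have := hl s
      simp only [Measure.smul_apply] at this ⊢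
      calc withGauss u s = (3 / 2 : NNReal) • (2 / 3 : NNReal) • withGauss u s := by
            rw [smul_smul, show (3 / 2 : NNReal) * (2 / 3) = 1 by ext; push_cast; norm_num, one_smul]
        _ ≤ (3 / 2 : NNReal) • withGauss g s := by
            simp only [ENNReal.smul_def, smul_eq_mul] at this ⊢
            gcongr
    convert h1 using 2
    ext; push_cast; norm_num
  · refine (integral_abs_tensorPow_le hg hu ht.le (N ^ 2) hgL).trans_eq ?_
    push_cast
    ring_nf
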